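/- Work over $\mathbb C$, and let $|\mathcal O_{\mathbb P^2}(6)|=\mathbb P^{27}$ be the projective space of plane sextic curves. Let $V^{irr}_{6,10}(\mathbb P^2)\subset|\mathcal O_{\mathbb P^2}(6)|$ be the Severi variety of irreducible $10$-nodal sextics, i.e. the Zariski closure, with its reduced structure, of the set of integral nodal plane sextics with at least $10$ nodes. Let $\mathscr S=\mathscr T+\overline{\mathscr T}$ be the union of six lines in general position (pairwise distinct, no three through one point), where $\mathscr T$ and $\overline{\mathscr T}$ are each the union of three of the six lines; so $\mathscr T$ and $\overline{\mathscr T}$ are triangles without common sides or vertices. Then $\mathscr S\in V^{irr}_{6,10}(\mathbb P^2)$, and for every plane cubic $\mathscr F$ the pencil $\mathscr S+t(\mathscr T+\mathscr F)$, i.e. the linear span of $\mathscr S$ and $\mathscr T+\mathscr F$ in $|\mathcal O_{\mathbb P^2}(6)|$, is tangent to $V^{irr}_{6,10}(\mathbb P^2)$ at $\mathscr S$: it is contained in the projective (Zariski) tangent space of $V^{irr}_{6,10}(\mathbb P^2)$ at $\mathscr S$. If $\mathscr F\neq\overline{\mathscr T}$, this pencil is a line, hence a tangent line; if $\mathscr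 F=\overline{\mathscr T}$, it is the single point $\mathscr S$. -/

import Mathlib

noncomputable section

/-- Ternary forms of degree `m` over `ℂ`, that is, `H⁰(ℙ², 𝒪(m))`. -/
abbrev TernaryForm (m : ℕ) : Type := MvPolynomial.homogeneousSubmodule (Fin 3) ℂ m

/-- The complex projective plane. -/
abbrev ProjPlane : Type := Projectivization ℂ (Fin 3 → ℂ)

/-- Plane curves of degree `m` (effective divisors): the projective space `|𝒪_{ℙ²}(m)|` of nonzero
forms of degree `m` up to scalars. For `m = 6` this is `ℙ²⁷`. -/
abbrev PlaneCurve (m : ℕ) : Type := Projectivization ℂ (TernaryForm m)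

namespace PlaneCurve

/-- An equation of the curve (unique up to a nonzero scalar). -/
def equation {m : ℕ} (Γ : PlaneCurve m) : MvPolynomial (Fin 3) ℂ := (Γ.rep : TernaryForm m)

theorem equation_ne_zero {m : ℕ} (Γ : PlaneCurve m) : Γ.equation ≠ 0 :=
  fun h => Γ.rep_nonzero (Subtype.ext h)

/-- The sum `Γ + Δ` of two plane curves as divisors: the curve whose equation is the product of the
two equations. -/
def sum {a b : ℕ} (Γ : PlaneCurve a) (Δ : PlaneCurve b) : PlaneCurve (a + b) :=
  Projectivization.mk ℂ
    (⟨Γ.equation * Δ.equation,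
      MvPolynomial.IsHomogeneous.mul (Γ.rep : TernaryForm a).2 (Δ.rep : TernaryForm b).2⟩ :
        TernaryForm (a + b))
    (fun h => mul_ne_zero Γ.equation_ne_zero Δ.equation_ne_zero (congrArg Subtype.val h))

/-- The point `x` lies on the curve `Γ`. -/
def Contains {m : ℕ} (Γ : PlaneCurve m) (x : ProjPlane) : Prop :=
  MvPolynomial.eval x.rep Γ.equation = 0

/-- The singular points of `Γ`: the points of `Γ` where all the partial derivatives of the equation
vanish. -/
def singularPoints {m : ℕ} (Γ : PlaneCurve m) : Set ProjPlane :=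
  {x | Γ.Contains x ∧
    ∀ i : Fin 3, MvPolynomial.eval x.rep (MvPolynomial.pderiv i Γ.equation) = 0}

/-- The `3 × 3` Hessian matrix of the equation of `Γ` at `x`. -/
def hessian {m : ℕ} (Γ : PlaneCurve m) (x : ProjPlane) : Matrix (Fin 3) (Fin 3) ℂ :=
  Matrix.of fun i j =>
    MvPolynomial.eval x.rep (MvPolynomial.pderiv i (MvPolynomial.pderiv j Γ.equation))

/-- `x` is a node (ordinary double point) of `Γ`. At a singular point `x` the line spanned by a
representative of `x` lies in the kernel of the Hessian, and the Hessian induces on the quotient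
plane (the tangent plane of `ℙ²` at `x`, up to a twist) the quadratic part of a local equation of
`Γ`. Hence this quadratic part is nondegenerate, that is, `Γ` has at `x` two distinct tangent
lines, if and only if the Hessian has rank two. -/
def IsNode {m : ℕ} (Γ : PlaneCurve m) (x : ProjPlane) : Prop :=
  x ∈ Γ.singularPoints ∧ (Γ.hessian x).rank = 2

/-- All the singular points of `Γ` are nodes (in particular `Γ` is reduced). -/
def IsNodal {m : ℕ} (Γ : PlaneCurve m) : Prop :=
  ∀ x ∈ Γ.singularPoints, Γ.IsNode x

/-- `Γ` is an integral curve. -/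
def IsIntegral {m : ℕ} (Γ : PlaneCurve m) : Prop := Irreducible Γ.equation

/-- Exponents of the monomials of degree `m` in three variables; they index the homogeneous
coordinates of `|𝒪_{ℙ²}(m)|`. -/
abbrev MonomialIndex (m : ℕ) : Type :=
  (Finset.finsuppAntidiag (Finset.univ : Finset (Fin 3)) m : Finset (Fin 3 →₀ ℕ))

/-- The homogeneous coordinates of `Γ` in `|𝒪_{ℙ²}(m)|`: the coefficients of an equation. -/
def coords {m : ℕ} (Γ : PlaneCurve m) : MonomialIndex m → ℂ :=
  fun d => MvPolynomial.coeff d.1 Γ.equation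

/-- The homogeneous polynomials on `|𝒪_{ℙ²}(m)|` that vanish on `X`; they generate the homogeneous
ideal of the reduced closed subvariety `X` if `X` is closed. -/
def homogeneousVanishing {m : ℕ} (X : Set (PlaneCurve m)) :
    Set (MvPolynomial (MonomialIndex m) ℂ) :=
  {P | (∃ k : ℕ, P.IsHomogeneous k) ∧ ∀ Γ ∈ X, MvPolynomial.eval Γ.coords P = 0}

/-- The Zariski closure of a subset of the projective space `|𝒪_{ℙ²}(m)|`. -/
def zariskiClosure {m : ℕ} (X : Set (PlaneCurve m)) : Set (PlaneCurve m) :=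
  {Γ | ∀ P ∈ homogeneousVanishing X, MvPolynomial.eval Γ.coords P = 0}

/-- The (embedded) projective Zariski tangent space at `Γ` of the closed subvariety `X` of
`|𝒪_{ℙ²}(m)|`: the points `Δ` with `∑ (∂P/∂z_d)(Γ) · Δ_d = 0` for every `P` in the homogeneous ideal
of `X`. -/
def projectiveTangentSpace {m : ℕ} (X : Set (PlaneCurve m)) (Γ : PlaneCurve m) :
    Set (PlaneCurve m) :=
  {Δ | ∀ P ∈ homogeneousVanishing X,
    ∑ d : MonomialIndex m,
      MvPolynomial.eval Γ.coords (MvPolynomial.pderiv d P) * Δ.coords d = 0}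

/-- The pencil spanned by `Γ` and `Δ`, consisting of `Δ` and of all the curves `Γ + tΔ`, given by
the linear subspace of forms that defines it. It is a line if and only if this subspace has
dimension two, that is, if `Γ ≠ Δ`. -/
def pencil {m : ℕ} (Γ Δ : PlaneCurve m) : Submodule ℂ (TernaryForm m) :=
  Γ.submodule ⊔ Δ.submodule

/-- The linear subspace of `|𝒪_{ℙ²}(m)|` given by the space of forms `W` is tangent to `X` at `Γ`:
the point `Γ` lies on both, and the linear subspace is contained in the projective tangent space
of `X` at `Γ`. -/
def IsTangentAt {m : ℕ} (W : Submodule ℂ (TernaryForm m)) (X : Set (PlaneCurve m))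
    (Γ : PlaneCurve m) : Prop :=
  Γ ∈ X ∧ Γ.submodule ≤ W ∧
    ∀ Δ : PlaneCurve m, Δ.submodule ≤ W → Δ ∈ projectiveTangentSpace X Γ

/-- The Severi variety `V_{m,δ}^{irr}(ℙ²)`: the Zariski closure in `|𝒪_{ℙ²}(m)|` of the family of
integral nodal curves of degree `m` with at least `δ` nodes. -/
def severiIrr (m δ : ℕ) : Set (PlaneCurve m) :=
  zariskiClosure {Γ | Γ.IsIntegral ∧ Γ.IsNodal ∧ (δ : ℕ∞) ≤ Γ.singularPoints.encard}

/-- A family of lines in general position: the lines are pairwise distinct and no three of them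
pass through one point. -/
def InGeneralPosition {ι : Type} (L : ι → PlaneCurve 1) : Prop :=
  Function.Injective L ∧
    ∀ i j k : ι, i ≠ j → i ≠ k → j ≠ k →
      ∀ x : ProjPlane, ¬ ((L i).Contains x ∧ (L j).Contains x ∧ (L k).Contains x)

/-- The union (sum) of three lines, as a plane cubic. -/
def threeLines (L : Fin 3 → PlaneCurve 1) : PlaneCurve 3 :=
  ((L 0).sum (L 1)).sum (L 2)

end PlaneCurve

end

/-!
The union `S` of six general lines has `15` nodes, one for each pair of lines. The proof shows that
the Zariski tangent space of the Severi variety at `S` is the whole projective space of sextics, so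
that each line through `S`, in particular the given pencil, is tangent to it.

Near `S` the critical value at each node is a differentiable function of the coefficients of the
form, whose differential is, up to the factor given by the degree, the evaluation at the node
(`IsNodeVec.exists_critical_value`, by the implicit function theorem). The nodes of a general
arrangement of lines impose independent conditions on forms of the same degree
(`IsGeneral.exists_dual_forms`), so the critical values are part of a local coordinate system; hence
every form `v` is the velocity of an arc through `S` on which exactly the nodes where `v` does not
vanish are smoothed (`exists_arc`).

If these are the five nodes on one of the six lines, then the curves on the arc near `S` have ten
nodes, and they are
* nodal, because being a node is an open condition and the projective plane is compact
  (`eventually_isNodeVec`);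
* irreducible: a limit of splittings would be a splitting of `S`, and the two parts of `S` meet in a
  node on the chosen line (`IsGeneral.exists_common_node`). They meet transversally, so
  nearby splittings would have a singular point near this node, although it is smoothed
  (`eventually_irreducible`).

So `S` is in the Severi variety, and the differential at `S` of each of its equations vanishes on
every such `v`. Each node lies on a line, so these `v` span the space of all forms
(`IsGeneral.gradCLM_eq_zero`).

The argument is carried out for general arrangements of `n ≥ 2` lines. A curve is represented by
the vector of coefficients of an equation, and a point of the plane by a nonzero vector.
-/

namespace PlaneCurve

open MvPolynomial Filter Topology Matrix

/-! ### Forms and their coefficient vectors -/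

/-- The coefficient vectors of ternary forms of degree `m`, with the norm of a finite power
of `ℂ`. -/
abbrev CoeffVec (m : ℕ) : Type := MonomialIndex m → ℂ

/-- The form of degree `m` with a given coefficient vector. -/
noncomputable def formOf (m : ℕ) : CoeffVec m →ₗ[ℂ] MvPolynomial (Fin 3) ℂ :=
  ∑ d : MonomialIndex m, (monomial d.1).comp (LinearMap.proj d)

theorem formOf_apply {m : ℕ} (c : CoeffVec m) :
    formOf m c = ∑ d : MonomialIndex m, monomial d.1 (c d) := by
  simp [formOf]

theorem degree_monomialIndex {m : ℕ} (d : MonomialIndex m) : d.1.degree = m := by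
  have h := (Finset.mem_finsuppAntidiag.1 d.2).1
  rw [Finsupp.degree_eq_sum]
  exact h

theorem isHomogeneous_formOf {m : ℕ} (c : CoeffVec m) : (formOf m c).IsHomogeneous m := by
  rw [formOf_apply]
  exact IsHomogeneous.sum _ _ _ fun d _ => isHomogeneous_monomial _ (degree_monomialIndex d)

theorem coeff_formOf {m : ℕ} (c : CoeffVec m) (d : MonomialIndex m) :
    coeff d.1 (formOf m c) = c d := by
  classical
  rw [formOf_apply, coeff_sum]
  simp only [coeff_monomial, Subtype.coe_inj]
  simp

theorem formOf_injective (m : ℕ) : Function.Injective (formOf m) := fun c c' h => by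
  ext d
  rw [← coeff_formOf c, h, coeff_formOf]

theorem formOf_eq_zero_iff {m : ℕ} {c : CoeffVec m} : formOf m c = 0 ↔ c = 0 :=
  (formOf m).map_eq_zero_iff (formOf_injective m)

/-- The coefficient vector of the degree `m` part of a polynomial. -/
def coeffVec (m : ℕ) (F : MvPolynomial (Fin 3) ℂ) : CoeffVec m := fun d => coeff d.1 F

theorem formOf_coeffVec {m : ℕ} {F : MvPolynomial (Fin 3) ℂ} (hF : F.IsHomogeneous m) :
    formOf m (coeffVec m F) = F := by
  ext e
  by_cases he : e.degree = m
  · have : e ∈ Finset.finsuppAntidiag (Finset.univ : Finset (Fin 3)) m := by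
      rw [Finset.mem_finsuppAntidiag]
      refine ⟨?_, Finset.subset_univ _⟩
      rw [← he, Finsupp.degree_eq_sum]
    exact coeff_formOf (coeffVec m F) ⟨e, this⟩
  · rw [(isHomogeneous_formOf _).coeff_eq_zero he, hF.coeff_eq_zero he]

/-- Euler's identity at a point. -/
theorem euler_eval {F : MvPolynomial (Fin 3) ℂ} {m : ℕ} (hF : F.IsHomogeneous m)
    (x : Fin 3 → ℂ) : ∑ i, x i * eval x (pderiv i F) = m * eval x F := by
  have h := congrArg (eval x) hF.sum_X_mul_pderiv
  simpa using h

theorem eval_smul_point {σ : Type*} [Fintype σ] {F : MvPolynomial σ ℂ} {m : ℕ}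
    (hF : F.IsHomogeneous m) (r : ℂ) (x : σ → ℂ) : eval (r • x) F = r ^ m * eval x F := by
  rw [eval_eq', eval_eq', Finset.mul_sum]
  refine Finset.sum_congr rfl fun d hd => ?_
  have hdeg : ∑ i, d i = m := by
    rw [← Finsupp.degree_eq_sum]
    by_contra h
    exact (mem_support_iff.1 hd) (hF.coeff_eq_zero h)
  simp only [Pi.smul_apply, smul_eq_mul, mul_pow, Finset.prod_mul_distrib]
  rw [Finset.prod_pow_eq_pow_sum, hdeg]
  ring

theorem pderiv_pderiv_comm (i j : Fin 3) (F : MvPolynomial (Fin 3) ℂ) :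
    pderiv i (pderiv j F) = pderiv j (pderiv i F) := by
  have h : ⁅pderiv (R := ℂ) i, pderiv (R := ℂ) j⁆ = 0 := by
    refine derivation_ext fun k => ?_
    simp [Derivation.commutator_apply, pderiv_X, Pi.single_apply, apply_ite]
  have := DFunLike.congr_fun h F
  rwa [Derivation.commutator_apply, Derivation.zero_apply, sub_eq_zero] at this

/-! ### Differentiating the value of a form at a point -/

/-- The differential at `x` of the polynomial function of `F`. -/
noncomputable def gradCLM {σ : Type*} [Fintype σ] (F : MvPolynomial σ ℂ) (x : σ → ℂ) :
    (σ → ℂ) →L[ℂ] ℂ :=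
  ∑ j, eval x (pderiv j F) • ContinuousLinearMap.proj j

theorem gradCLM_apply {σ : Type*} [Fintype σ] (F : MvPolynomial σ ℂ) (x y : σ → ℂ) :
    gradCLM F x y = ∑ j, eval x (pderiv j F) * y j := by
  simp [gradCLM]

theorem hasStrictFDerivAt_eval {σ : Type*} [Fintype σ] (F : MvPolynomial σ ℂ) (x : σ → ℂ) :
    HasStrictFDerivAt (fun x => eval x F) (gradCLM F x) x := by
  classical
  induction F using MvPolynomial.induction_on with
  | C a =>
    have h0 : gradCLM (C a) x = 0 := by ext y; simp [gradCLM_apply]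
    simpa [h0] using hasStrictFDerivAt_const (𝕜 := ℂ) a x
  | add p q hp hq =>
    simp only [map_add]
    refine (hp.add hq).congr_fderiv ?_
    refine ContinuousLinearMap.ext fun y => ?_
    simp [gradCLM_apply, Finset.sum_add_distrib, add_mul]
  | mul_X p n hp =>
    simp only [map_mul, eval_X]
    refine (hp.mul (hasStrictFDerivAt_apply n x)).congr_fderiv ?_
    refine ContinuousLinearMap.ext fun y => ?_
    have h : ∀ j, eval x (if n = j then p else 0) = if n = j then eval x p else 0 := fun j => by
      split_ifs <;> simp
    simp [gradCLM_apply, pderiv_X, Pi.single_apply, add_mul, Finset.sum_add_distrib,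
      Finset.mul_sum, h, add_comm, mul_assoc]

/-- The linear form `c ↦ (D F_c)(x)` on coefficient vectors, for a linear operator `D`. -/
noncomputable def evalCLM {m : ℕ} (D : MvPolynomial (Fin 3) ℂ →ₗ[ℂ] MvPolynomial (Fin 3) ℂ)
    (x : Fin 3 → ℂ) : CoeffVec m →L[ℂ] ℂ :=
  LinearMap.toContinuousLinearMap ((aeval x).toLinearMap ∘ₗ D ∘ₗ formOf m)

@[simp] theorem evalCLM_apply {m : ℕ}
    (D : MvPolynomial (Fin 3) ℂ →ₗ[ℂ] MvPolynomial (Fin 3) ℂ) (x : Fin 3 → ℂ) (c : CoeffVec m) :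
    evalCLM D x c = eval x (D (formOf m c)) := by
  simp [evalCLM]

theorem hasStrictFDerivAt_eval_formOf {m : ℕ}
    (D : MvPolynomial (Fin 3) ℂ →ₗ[ℂ] MvPolynomial (Fin 3) ℂ) (z : CoeffVec m × (Fin 3 → ℂ)) :
    HasStrictFDerivAt (fun z : CoeffVec m × (Fin 3 → ℂ) => eval z.2 (D (formOf m z.1)))
      ((evalCLM D z.2).comp (.fst ℂ _ _) +
        (gradCLM (D (formOf m z.1)) z.2).comp (.snd ℂ _ _)) z := by
  have key : ∀ c : CoeffVec m, D (formOf m c) = ∑ d, c d • D (monomial d.1 1) := fun c => by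
    rw [formOf_apply, map_sum]
    refine Finset.sum_congr rfl fun d _ => ?_
    rw [← map_smul, smul_monomial, smul_eq_mul, mul_one]
  have h : HasStrictFDerivAt
      (fun z : CoeffVec m × (Fin 3 → ℂ) => ∑ d, z.1 d * eval z.2 (D (monomial d.1 1))) _ z :=
    HasStrictFDerivAt.fun_sum fun d _ =>
      (((ContinuousLinearMap.proj (R := ℂ) (φ := fun _ : MonomialIndex m => ℂ) d).hasStrictFDerivAt
        (x := z.1)).comp z
        (hasStrictFDerivAt_fst)).mul
      ((hasStrictFDerivAt_eval (D (monomial d.1 1)) z.2).comp z hasStrictFDerivAt_snd)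
  have e : (fun z : CoeffVec m × (Fin 3 → ℂ) => eval z.2 (D (formOf m z.1))) =
      fun z => ∑ d, z.1 d * eval z.2 (D (monomial d.1 1)) := by
    funext z
    simp [key]
  rw [e]
  refine h.congr_fderiv ?_
  refine ContinuousLinearMap.ext fun w => ?_
  simp only [_root_.sum_apply, _root_.add_apply,
    _root_.smul_apply, ContinuousLinearMap.comp_apply, ContinuousLinearMap.coe_fst',
    ContinuousLinearMap.coe_snd', evalCLM_apply, gradCLM_apply, ContinuousLinearMap.proj_apply,
    smul_eq_mul, key, map_sum, Derivation.map_smul, smul_eval, Finset.sum_add_distrib,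
    Finset.mul_sum, Finset.sum_mul]
  rw [add_comm, Finset.sum_comm (s := (Finset.univ : Finset (Fin 3)))]
  congr 1
  · exact Finset.sum_congr rfl fun d _ => mul_comm _ _
  · exact Finset.sum_congr rfl fun d _ => Finset.sum_congr rfl fun j _ => by ring

theorem continuous_eval_formOf {m : ℕ}
    (D : MvPolynomial (Fin 3) ℂ →ₗ[ℂ] MvPolynomial (Fin 3) ℂ) :
    Continuous fun z : CoeffVec m × (Fin 3 → ℂ) => eval z.2 (D (formOf m z.1)) :=
  continuous_iff_continuousAt.2 fun z => (hasStrictFDerivAt_eval_formOf D z).continuousAt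

/-! ### The critical value at a node -/

/-- The vector `p` represents an ordinary double point of `F = 0`: all partial derivatives vanish
at `p`, and the kernel of the Hessian at `p` is the line spanned by `p`. -/
structure IsNodeVec (F : MvPolynomial (Fin 3) ℂ) (p : Fin 3 → ℂ) : Prop where
  ne_zero : p ≠ 0
  pderiv_eq_zero : ∀ i, eval p (pderiv i F) = 0
  ker_hessian : ∀ y : Fin 3 → ℂ,
    (∀ i, ∑ j, eval p (pderiv j (pderiv i F)) * y j = 0) → ∃ μ : ℂ, y = μ • p

/-- The Lagrange system for the critical points of the form `F_c` on the affine plane `ξ = 1`, with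
multiplier `l`. By Euler's identity the multiplier at a critical point is `m` times the
critical value. -/
noncomputable def lagrangeSystem {m : ℕ} (ξ : Fin 3 → ℂ) (z : CoeffVec m × ((Fin 3 → ℂ) × ℂ)) :
    (Fin 3 → ℂ) × ℂ :=
  (fun i => eval z.2.1 (pderiv i (formOf m z.1)) - z.2.2 * ξ i, ∑ i, ξ i * z.2.1 i - 1)

/-- The differential of the Lagrange system at a point with multiplier `0`. -/
noncomputable def lagrangeDeriv {m : ℕ} (ξ : Fin 3 → ℂ) (c : CoeffVec m) (p : Fin 3 → ℂ) :
    CoeffVec m × ((Fin 3 → ℂ) × ℂ) →L[ℂ] (Fin 3 → ℂ) × ℂ :=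
  (ContinuousLinearMap.pi fun i =>
    (evalCLM (pderiv i).toLinearMap p).comp (.fst ℂ _ _) +
      (gradCLM (pderiv i (formOf m c)) p).comp ((ContinuousLinearMap.fst ℂ _ _).comp (.snd ℂ _ _))
      - ξ i • (ContinuousLinearMap.snd ℂ _ _).comp (.snd ℂ _ _)).prod
  ((∑ i, ξ i • ContinuousLinearMap.proj i).comp
    ((ContinuousLinearMap.fst ℂ _ _).comp (.snd ℂ _ _)))

theorem lagrangeDeriv_apply {m : ℕ} (ξ : Fin 3 → ℂ) (c : CoeffVec m) (p : Fin 3 → ℂ)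
    (w : CoeffVec m × ((Fin 3 → ℂ) × ℂ)) :
    lagrangeDeriv ξ c p w =
      (fun i => eval p (pderiv i (formOf m w.1)) +
        ∑ j, eval p (pderiv j (pderiv i (formOf m c))) * w.2.1 j - ξ i * w.2.2,
        ∑ i, ξ i * w.2.1 i) := by
  ext <;> simp [lagrangeDeriv, gradCLM_apply]

theorem hasStrictFDerivAt_lagrangeSystem {m : ℕ} (ξ : Fin 3 → ℂ) (c : CoeffVec m)
    (p : Fin 3 → ℂ) :
    HasStrictFDerivAt (lagrangeSystem ξ) (lagrangeDeriv ξ c p) (c, (p, 0)) := by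
  have hx : HasStrictFDerivAt (fun z : CoeffVec m × ((Fin 3 → ℂ) × ℂ) => (z.1, z.2.1))
      ((ContinuousLinearMap.fst ℂ _ _).prod
        ((ContinuousLinearMap.fst ℂ _ _).comp (.snd ℂ _ _))) (c, (p, (0 : ℂ))) :=
    ((ContinuousLinearMap.fst ℂ (CoeffVec m) ((Fin 3 → ℂ) × ℂ)).prod
      ((ContinuousLinearMap.fst ℂ (Fin 3 → ℂ) ℂ).comp (.snd ℂ _ _))).hasStrictFDerivAt
  have hl : HasStrictFDerivAt (fun z : CoeffVec m × ((Fin 3 → ℂ) × ℂ) => z.2.2)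
      ((ContinuousLinearMap.snd ℂ _ _).comp (.snd ℂ _ _)) (c, (p, (0 : ℂ))) :=
    ((ContinuousLinearMap.snd ℂ (Fin 3 → ℂ) ℂ).comp
      (.snd ℂ (CoeffVec m) ((Fin 3 → ℂ) × ℂ))).hasStrictFDerivAt
  have h1 : ∀ i, HasStrictFDerivAt
      (fun z : CoeffVec m × ((Fin 3 → ℂ) × ℂ) =>
        eval z.2.1 (pderiv i (formOf m z.1)) - z.2.2 * ξ i)
      ((evalCLM (pderiv i).toLinearMap p).comp (.fst ℂ _ _) +
      (gradCLM (pderiv i (formOf m c)) p).comp ((ContinuousLinearMap.fst ℂ _ _).comp (.snd ℂ _ _))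
      - ξ i • (ContinuousLinearMap.snd ℂ _ _).comp (.snd ℂ _ _)) (c, (p, (0 : ℂ))) := fun i => by
    have h := HasStrictFDerivAt.comp (c, (p, (0 : ℂ)))
      (g := fun z : CoeffVec m × (Fin 3 → ℂ) => eval z.2 (pderiv i (formOf m z.1)))
      (hasStrictFDerivAt_eval_formOf (pderiv i).toLinearMap (c, p)) hx
    exact h.sub (hl.mul_const (ξ i))
  have h2 : HasStrictFDerivAt
      (fun z : CoeffVec m × ((Fin 3 → ℂ) × ℂ) => ∑ i, ξ i * z.2.1 i - 1)
      ((∑ i, ξ i • ContinuousLinearMap.proj i).comp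
        ((ContinuousLinearMap.fst ℂ _ _).comp (.snd ℂ _ _))) (c, (p, (0 : ℂ))) := by
    have h := (((∑ i, ξ i • ContinuousLinearMap.proj (R := ℂ) (φ := fun _ : Fin 3 => ℂ) i).comp
      ((ContinuousLinearMap.fst ℂ (Fin 3 → ℂ) ℂ).comp
        (.snd ℂ (CoeffVec m) _))).hasStrictFDerivAt (x := (c, (p, (0 : ℂ))))).sub_const 1
    simpa using h
  exact (hasStrictFDerivAt_pi.2 h1).prodMk h2

/-- At a singular point `p`, the vector `p` is orthogonal to the image of the Hessian. -/
theorem IsNodeVec.sum_hessian_mul {F : MvPolynomial (Fin 3) ℂ} {m : ℕ} (hF : F.IsHomogeneous m)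
    {p : Fin 3 → ℂ} (hp : ∀ i, eval p (pderiv i F) = 0) (y : Fin 3 → ℂ) :
    ∑ i, p i * ∑ j, eval p (pderiv j (pderiv i F)) * y j = 0 := by
  have h : ∀ j, ∑ i, p i * eval p (pderiv i (pderiv j F)) = 0 := fun j => by
    rw [euler_eval (hF.pderiv (i := j)), hp j, mul_zero]
  calc _ = ∑ j, y j * ∑ i, p i * eval p (pderiv i (pderiv j F)) := by
        simp only [Finset.mul_sum]
        rw [Finset.sum_comm]
        refine Finset.sum_congr rfl fun j _ => Finset.sum_congr rfl fun i _ => ?_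
        rw [pderiv_pderiv_comm j i]; ring
    _ = 0 := by simp [h]

theorem exists_normalizing_covector {p : Fin 3 → ℂ} (hp : p ≠ 0) :
    ∃ ξ : Fin 3 → ℂ, ∑ i, ξ i * p i = 1 := by
  obtain ⟨a, ha⟩ := Function.ne_iff.1 hp
  exact ⟨Pi.single a (p a)⁻¹, by simpa [Pi.single_apply] using inv_mul_cancel₀ ha⟩

/-- Near a curve with a node at `p`, the nodal critical point deforms to `φ`, and the critical
value (up to the factor `m`) is a function `lam` with differential `m` times evaluation at `p`; the
node persists if and only if `lam` vanishes. -/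
theorem IsNodeVec.exists_critical_value {m : ℕ} {c : CoeffVec m} {p : Fin 3 → ℂ}
    (h : IsNodeVec (formOf m c) p) :
    ∃ (φ : CoeffVec m → Fin 3 → ℂ) (lam : CoeffVec m → ℂ),
      Tendsto φ (𝓝 c) (𝓝 p) ∧ lam c = 0 ∧
      HasStrictFDerivAt lam ((m : ℂ) • evalCLM LinearMap.id p) c ∧
      (∀ᶠ c' in 𝓝 c, lam c' = 0 → ∀ i, eval (φ c') (pderiv i (formOf m c')) = 0) ∧
      ∀ᶠ z in 𝓝 (c, p), (∀ i, eval z.2 (pderiv i (formOf m z.1)) = 0) → lam z.1 = 0 := by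
  obtain ⟨ξ, hξ⟩ := exists_normalizing_covector h.ne_zero
  have hhom := isHomogeneous_formOf c
  have hF := hasStrictFDerivAt_lagrangeSystem ξ c p
  have hval : lagrangeSystem ξ (c, (p, (0 : ℂ))) = 0 := by
    ext <;> simp [lagrangeSystem, h.pderiv_eq_zero, hξ]
  -- Pairing the gradient equations with `p` isolates the multiplier.
  have hmult : ∀ w : CoeffVec m × ((Fin 3 → ℂ) × ℂ), lagrangeDeriv ξ c p w = 0 →
      w.2.2 = m * eval p (formOf m w.1) := fun w hw => by
    rw [lagrangeDeriv_apply] at hw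
    have h1 : ∀ i, eval p (pderiv i (formOf m w.1)) +
        ∑ j, eval p (pderiv j (pderiv i (formOf m c))) * w.2.1 j - ξ i * w.2.2 = 0 := fun i =>
      congrFun (congrArg Prod.fst hw) i
    have h2 : ∑ i, p i * (eval p (pderiv i (formOf m w.1)) +
        ∑ j, eval p (pderiv j (pderiv i (formOf m c))) * w.2.1 j - ξ i * w.2.2) = 0 := by
      simp [h1]
    have h3 : ∑ i, p i * (ξ i * w.2.2) = w.2.2 := by
      calc _ = (∑ i, ξ i * p i) * w.2.2 := by
            rw [Finset.sum_mul]; exact Finset.sum_congr rfl fun i _ => by ring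
        _ = _ := by rw [hξ, one_mul]
    simp only [mul_sub, mul_add, Finset.sum_sub_distrib, Finset.sum_add_distrib] at h2
    rw [euler_eval (isHomogeneous_formOf w.1), IsNodeVec.sum_hessian_mul hhom h.pderiv_eq_zero, h3]
      at h2
    linear_combination -h2
  have hinj : Function.Injective (lagrangeDeriv ξ c p ∘L .inr ℂ _ _) := by
    rw [injective_iff_map_eq_zero]
    rintro ⟨y, l⟩ hy
    have hy' : lagrangeDeriv ξ c p (0, (y, l)) = 0 := hy
    have hl : l = 0 := by simpa using hmult _ hy'
    subst hl
    rw [lagrangeDeriv_apply] at hy'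
    obtain ⟨μ, rfl⟩ := h.ker_hessian y fun i => by
      simpa using congrFun (congrArg Prod.fst hy') i
    have h3 : ∑ i, ξ i * (μ * p i) = 0 := by simpa using congrArg Prod.snd hy'
    have hμ : μ = 0 := by
      calc μ = μ * ∑ i, ξ i * p i := by rw [hξ, mul_one]
        _ = ∑ i, ξ i * (μ * p i) := by
            rw [Finset.mul_sum]; exact Finset.sum_congr rfl fun i _ => by ring
        _ = 0 := h3
    simp [hμ]
  have hinv : (lagrangeDeriv ξ c p ∘L .inr ℂ _ _).IsInvertible :=
    ⟨(LinearEquiv.ofInjectiveEndo _ hinj).toContinuousLinearEquiv,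
      ContinuousLinearMap.ext fun _ => rfl⟩
  set ψ := hF.implicitFunctionOfProdDomain hinv with hψ
  have hψ' := hF.hasStrictFDerivAt_implicitFunctionOfProdDomain hinv
  have htend : Tendsto ψ (𝓝 c) (𝓝 (p, 0)) := hF.tendsto_implicitFunctionOfProdDomain hinv
  have hev : ∀ᶠ c' in 𝓝 c, lagrangeSystem ξ (c', ψ c') = 0 := by
    have := hF.eventually_apply_implicitFunctionOfProdDomain hinv
    rwa [hval] at this
  have huniq := hF.eventually_apply_eq_iff_implicitFunctionOfProdDomain hinv
  rw [hval] at huniq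
  have hψc : ψ c = (p, 0) := huniq.self_of_nhds.1 hval
  refine ⟨fun c' => (ψ c').1, fun c' => (ψ c').2, htend.fst_nhds, by simp [hψc], ?_, ?_, ?_⟩
  · refine (hasStrictFDerivAt_snd.comp c hψ').congr_fderiv ?_
    refine ContinuousLinearMap.ext fun v => ?_
    refine hmult (v, (-(lagrangeDeriv ξ c p ∘L .inr ℂ _ _).inverse ∘L
      (lagrangeDeriv ξ c p ∘L .inl ℂ _ _)) v) ?_
    rw [← (lagrangeDeriv ξ c p).comp_inl_add_comp_inr]
    simp [-ContinuousLinearMap.comp_apply, ContinuousLinearMap.coe_comp, map_neg, hinv]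
  · filter_upwards [hev] with c' hc' hl i
    have := congrFun (congrArg Prod.fst hc') i
    simpa [lagrangeSystem, hl] using this
  · -- A singular point near `p` can be rescaled to the plane `ξ = 1`.
    have hcont : ContinuousAt (fun z : CoeffVec m × (Fin 3 → ℂ) => ∑ i, ξ i * z.2 i) (c, p) :=
      Continuous.continuousAt (by fun_prop)
    have hne : ∀ᶠ z in 𝓝 (c, p), ∑ i, ξ i * z.2 i ≠ 0 :=
      hcont.eventually_ne (by simp [hξ])
    have hT : Tendsto (fun z : CoeffVec m × (Fin 3 → ℂ) =>
        (z.1, ((∑ i, ξ i * z.2 i)⁻¹ • z.2, (0 : ℂ)))) (𝓝 (c, p)) (𝓝 (c, (p, 0))) := by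
      have : ContinuousAt (fun z : CoeffVec m × (Fin 3 → ℂ) =>
        (z.1, ((∑ i, ξ i * z.2 i)⁻¹ • z.2, (0 : ℂ)))) (c, p) :=
        continuousAt_fst.prodMk
          (((hcont.inv₀ (by simp [hξ])).smul continuousAt_snd).prodMk continuousAt_const)
      simpa [ContinuousAt, hξ] using this
    filter_upwards [hne, hT.eventually huniq] with z hz hu hs
    have : lagrangeSystem ξ (z.1, ((∑ i, ξ i * z.2 i)⁻¹ • z.2, (0 : ℂ))) = 0 := by
      refine Prod.ext (funext fun i => ?_) ?_
      · simp only [lagrangeSystem, zero_mul, sub_zero]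
        rw [eval_smul_point (isHomogeneous_formOf z.1).pderiv, hs i, mul_zero]; rfl
      · simp only [lagrangeSystem, Pi.smul_apply, smul_eq_mul, Prod.snd_zero]
        rw [sub_eq_zero, ← mul_inv_cancel₀ hz, mul_comm, Finset.mul_sum]
        exact Finset.sum_congr rfl fun i _ => by ring
    exact congrArg Prod.snd (hu.1 this)

/-! ### Smoothing prescribed nodes along an arc -/

/-- If the nodes `p n` of a curve impose independent conditions on forms of degree `m`, then every
form `v` is the velocity of an arc of curves along which the nodes where `v` vanishes persist, and
the other ones are smoothed. The critical values at the nodes are part of a local coordinate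
system, and the arc is a straight line in these coordinates. -/
theorem exists_arc {m : ℕ} (hm : m ≠ 0) {N : Type*} [Fintype N] [DecidableEq N] {c : CoeffVec m}
    {p : N → Fin 3 → ℂ} (hnode : ∀ n, IsNodeVec (formOf m c) (p n)) {q : N → CoeffVec m}
    (hq : ∀ n k, eval (p k) (formOf m (q n)) = if n = k then 1 else 0) (v : CoeffVec m) :
    ∃ γ : ℂ → CoeffVec m, γ 0 = c ∧ HasDerivAt γ v 0 ∧
      (∀ n, eval (p n) (formOf m v) = 0 → ∃ φ : ℂ → Fin 3 → ℂ, Tendsto φ (𝓝 0) (𝓝 (p n)) ∧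
        ∀ᶠ t in 𝓝 0, ∀ i, eval (φ t) (pderiv i (formOf m (γ t))) = 0) ∧
      (∀ n, eval (p n) (formOf m v) ≠ 0 → ∀ᶠ z in 𝓝[≠] (0 : ℂ) ×ˢ 𝓝 (p n),
        ¬ ∀ i, eval z.2 (pderiv i (formOf m (γ z.1))) = 0) := by
  have hm' : (m : ℂ) ≠ 0 := Nat.cast_ne_zero.2 hm
  choose φ lam hφ hlam0 hlam hpers huniq using fun n => (hnode n).exists_critical_value
  set ev : N → CoeffVec m →L[ℂ] ℂ := fun n => evalCLM LinearMap.id (p n) with hev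
  have evq : ∀ n k, ev k (q n) = if n = k then 1 else 0 := fun n k => by simpa [hev] using hq n k
  -- `h` has differential the identity at `c`, and the critical values are linear functions of
  -- `h G`: the correction along `q` replaces the values of `G - c` at the nodes by critical values.
  set h : CoeffVec m → CoeffVec m :=
    fun G => (G - c) + ∑ n, ((m : ℂ)⁻¹ * lam n G - ev n (G - c)) • q n with hh
  have hh' : HasStrictFDerivAt h ((ContinuousLinearEquiv.refl ℂ (CoeffVec m) :
      CoeffVec m ≃L[ℂ] CoeffVec m) : CoeffVec m →L[ℂ] CoeffVec m) c := by
    have hsub : HasStrictFDerivAt (fun G : CoeffVec m => G - c)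
        (ContinuousLinearMap.id ℂ (CoeffVec m)) c := (hasStrictFDerivAt_id c).sub_const c
    have hsum := HasStrictFDerivAt.fun_sum (u := (Finset.univ : Finset N)) fun n _ =>
      ((((hlam n).const_mul ((m : ℂ)⁻¹)).sub ((ev n).hasStrictFDerivAt.comp c hsub)).smul_const
        (q n))
    refine (hsub.add hsum).congr_fderiv ?_
    refine ContinuousLinearMap.ext fun w => ?_
    simp [hev, hm']
  have hevh : ∀ k G, lam k G = m * ev k (h G) := fun k G => by
    simp only [hh, map_add, map_sum, map_smul, evq, smul_eq_mul, mul_ite, mul_one, mul_zero,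
      Finset.sum_ite_eq', Finset.mem_univ, if_true]
    field_simp
    ring
  have hc0 : h c = 0 := by simp [hh, hlam0]
  set g := hh'.localInverse h _ c with hg
  have hg' := hh'.to_localInverse
  have hright := hh'.eventually_right_inverse
  have hgc : g (h c) = c := hh'.localInverse_apply_image
  rw [hc0] at hg' hright hgc
  have hline : HasDerivAt (fun t : ℂ => t • v) v 0 := by
    simpa using (hasDerivAt_id (0 : ℂ)).smul_const v
  have hγ : HasDerivAt (fun t : ℂ => g (t • v)) v 0 := by
    have h0 : HasFDerivAt g (((ContinuousLinearEquiv.refl ℂ (CoeffVec m)).symm :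
      CoeffVec m ≃L[ℂ] CoeffVec m) : CoeffVec m →L[ℂ] CoeffVec m) ((0 : ℂ) • v) := by
      rw [zero_smul]; exact hg'.hasFDerivAt
    exact h0.comp_hasDerivAt (0 : ℂ) hline
  have hγ0 : g ((0 : ℂ) • v) = c := by rw [zero_smul, hgc]
  have hγt : Tendsto (fun t : ℂ => g (t • v)) (𝓝 0) (𝓝 c) := by
    have := hγ.continuousAt.tendsto
    rwa [hγ0] at this
  have hlt : Tendsto (fun t : ℂ => t • v) (𝓝 0) (𝓝 0) := by
    simpa using hline.continuousAt.tendsto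
  have hcrit : ∀ᶠ t : ℂ in 𝓝 0, ∀ n, lam n (g (t • v)) = m * (t * eval (p n) (formOf m v)) := by
    filter_upwards [hlt.eventually hright] with t ht n
    rw [hevh, ht, map_smul]
    simp [hev]
  refine ⟨fun t => g (t • v), hγ0, hγ, fun n hn => ?_, fun n hn => ?_⟩
  · refine ⟨fun t => φ n (g (t • v)), (hφ n).comp hγt, ?_⟩
    filter_upwards [hcrit, hγt.eventually (hpers n)] with t ht hpt
    exact hpt (by rw [ht n, hn, mul_zero, mul_zero])
  · have hT : Tendsto (fun z : ℂ × (Fin 3 → ℂ) => (g (z.1 • v), z.2))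
        (𝓝[≠] (0 : ℂ) ×ˢ 𝓝 (p n)) (𝓝 (c, p n)) := by
      rw [nhds_prod_eq]
      exact (hγt.mono_left nhdsWithin_le_nhds).prodMap tendsto_id
    have h1 : ∀ᶠ z in 𝓝[≠] (0 : ℂ) ×ˢ 𝓝 (p n), z.1 ≠ 0 :=
      tendsto_fst.eventually self_mem_nhdsWithin
    have h2 : ∀ᶠ z in 𝓝[≠] (0 : ℂ) ×ˢ 𝓝 (p n), ∀ n,
        lam n (g (z.1 • v)) = m * (z.1 * eval (p n) (formOf m v)) :=
      tendsto_fst.eventually (hcrit.filter_mono nhdsWithin_le_nhds)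
    filter_upwards [h1, h2, hT.eventually (huniq n)] with z hz hl hu hs
    have := hu hs
    rw [hl n] at this
    exact mul_ne_zero hm' (mul_ne_zero hz hn) this

/-! ### Nodality is an open condition -/

theorem IsNodeVec.smul {F : MvPolynomial (Fin 3) ℂ} {m : ℕ} (hF : F.IsHomogeneous m)
    {p : Fin 3 → ℂ} (h : IsNodeVec F p) {r : ℂ} (hr : r ≠ 0) : IsNodeVec F (r • p) where
  ne_zero := smul_ne_zero hr h.ne_zero
  pderiv_eq_zero i := by rw [eval_smul_point hF.pderiv, h.pderiv_eq_zero, mul_zero]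
  ker_hessian y hy := by
    obtain ⟨μ, rfl⟩ := h.ker_hessian y fun i => by
      have h1 := hy i
      simp only [eval_smul_point hF.pderiv.pderiv, mul_assoc, ← Finset.mul_sum] at h1
      exact (mul_eq_zero.1 h1).resolve_left (pow_ne_zero _ hr)
    exact ⟨μ * r⁻¹, by rw [smul_smul, inv_mul_cancel_right₀ hr]⟩

/-- The Hessian of `F` at `x`, bordered into an invertible matrix when `x` is a node: the
rank one summand `ξ ξᵀ` is nondegenerate on the kernel of the Hessian if `ξ · x ≠ 0`. -/
noncomputable def borderedHessian (ξ : Fin 3 → ℂ) (F : MvPolynomial (Fin 3) ℂ) (x : Fin 3 → ℂ) :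
    Matrix (Fin 3) (Fin 3) ℂ :=
  Matrix.of fun i j => eval x (pderiv j (pderiv i F)) + ξ i * ξ j

theorem borderedHessian_mulVec (ξ : Fin 3 → ℂ) (F : MvPolynomial (Fin 3) ℂ) (x y : Fin 3 → ℂ)
    (i : Fin 3) : (borderedHessian ξ F x *ᵥ y) i =
      ∑ j, eval x (pderiv j (pderiv i F)) * y j + ξ i * ∑ j, ξ j * y j := by
  simp only [borderedHessian, Matrix.mulVec, dotProduct, Matrix.of_apply, add_mul,
    Finset.sum_add_distrib, Finset.mul_sum, mul_assoc]

theorem IsNodeVec.det_borderedHessian_ne_zero {F : MvPolynomial (Fin 3) ℂ} {m : ℕ}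
    (hF : F.IsHomogeneous m) {p : Fin 3 → ℂ} (h : IsNodeVec F p) {ξ : Fin 3 → ℂ}
    (hξ : ∑ i, ξ i * p i = 1) : (borderedHessian ξ F p).det ≠ 0 := by
  intro hdet
  obtain ⟨y, hy0, hy⟩ := Matrix.exists_mulVec_eq_zero_iff.2 hdet
  have h1 : ∀ i, ∑ j, eval p (pderiv j (pderiv i F)) * y j + ξ i * ∑ j, ξ j * y j = 0 :=
    fun i => by rw [← borderedHessian_mulVec, hy]; rfl
  have h2 : ∑ j, ξ j * y j = 0 := by
    have h3 : ∑ i, p i * (∑ j, eval p (pderiv j (pderiv i F)) * y j + ξ i * ∑ j, ξ j * y j) = 0 :=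
      by simp [h1]
    simp only [mul_add, Finset.sum_add_distrib] at h3
    rw [IsNodeVec.sum_hessian_mul hF h.pderiv_eq_zero, zero_add] at h3
    calc ∑ j, ξ j * y j = (∑ i, ξ i * p i) * ∑ j, ξ j * y j := by rw [hξ, one_mul]
      _ = ∑ i, p i * (ξ i * ∑ j, ξ j * y j) := by
        rw [Finset.sum_mul]; exact Finset.sum_congr rfl fun i _ => by ring
      _ = 0 := h3
  obtain ⟨μ, rfl⟩ := h.ker_hessian y fun i => by simpa [h2] using h1 i
  have hμ : μ = 0 := by
    calc μ = μ * ∑ i, ξ i * p i := by rw [hξ, mul_one]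
      _ = ∑ j, ξ j * (μ • p) j := by
        rw [Finset.mul_sum]
        exact Finset.sum_congr rfl fun i _ => by rw [Pi.smul_apply, smul_eq_mul]; ring
      _ = 0 := h2
  exact hy0 (by simp [hμ])

theorem isNodeVec_of_det_borderedHessian_ne_zero {F : MvPolynomial (Fin 3) ℂ} {m : ℕ}
    (hF : F.IsHomogeneous m) {p : Fin 3 → ℂ} (hp : ∀ i, eval p (pderiv i F) = 0) {ξ : Fin 3 → ℂ}
    (hξ : ∑ i, ξ i * p i ≠ 0) (hdet : (borderedHessian ξ F p).det ≠ 0) : IsNodeVec F p where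
  ne_zero := by rintro rfl; simp at hξ
  pderiv_eq_zero := hp
  ker_hessian y hy := by
    refine ⟨(∑ i, ξ i * y i) / ∑ i, ξ i * p i, ?_⟩
    rw [← sub_eq_zero]
    by_contra hne
    refine hdet (Matrix.exists_mulVec_eq_zero_iff.1 ⟨_, hne, ?_⟩)
    funext i
    rw [borderedHessian_mulVec]
    have h1 : ∑ j, eval p (pderiv j (pderiv i F)) * p j = 0 := by
      have := euler_eval (hF.pderiv (i := i)) p
      rw [hp i, mul_zero] at this
      rw [← this]
      exact Finset.sum_congr rfl fun j _ => mul_comm _ _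
    have h2 := hy i
    simp only [Pi.sub_apply, Pi.smul_apply, smul_eq_mul, mul_sub, Finset.sum_sub_distrib,
      mul_left_comm _ ((∑ i, ξ i * y i) / ∑ i, ξ i * p i), ← Finset.mul_sum, h1, h2, Pi.zero_apply]
    field_simp
    ring

/-- If all the singular points of a curve are nodes, then this holds for all nearby curves. -/
theorem eventually_isNodeVec {m : ℕ} {c : CoeffVec m}
    (h : ∀ x ≠ 0, (∀ i, eval x (pderiv i (formOf m c)) = 0) → IsNodeVec (formOf m c) x) :
    ∀ᶠ c' in 𝓝 c, ∀ x ≠ 0, (∀ i, eval x (pderiv i (formOf m c')) = 0) →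
      IsNodeVec (formOf m c') x := by
  have hloc : ∀ x ∈ Metric.sphere (0 : Fin 3 → ℂ) 1, ∀ᶠ z in 𝓝 (c, x),
      (∀ i, eval z.2 (pderiv i (formOf m z.1)) = 0) → IsNodeVec (formOf m z.1) z.2 := by
    intro x hx
    have hx0 : x ≠ 0 := by rintro rfl; simp at hx
    by_cases hs : ∀ i, eval x (pderiv i (formOf m c)) = 0
    · have hn := h x hx0 hs
      obtain ⟨ξ, hξ⟩ := exists_normalizing_covector hx0
      have h1 : ∀ᶠ z in 𝓝 (c, x), ∑ i, ξ i * z.2 i ≠ 0 := by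
        have : Continuous fun z : CoeffVec m × (Fin 3 → ℂ) => ∑ i, ξ i * z.2 i := by fun_prop
        exact this.continuousAt.eventually_ne (by simp [hξ])
      have h2 : ∀ᶠ z in 𝓝 (c, x), (borderedHessian ξ (formOf m z.1) z.2).det ≠ 0 := by
        have : Continuous fun z : CoeffVec m × (Fin 3 → ℂ) =>
            (borderedHessian ξ (formOf m z.1) z.2).det := by
          refine Continuous.matrix_det (continuous_matrix fun i j => ?_)
          exact (continuous_eval_formOf ((pderiv j).toLinearMap ∘ₗ (pderiv i).toLinearMap)).add
            continuous_const
        exact this.continuousAt.eventually_ne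
          (hn.det_borderedHessian_ne_zero (isHomogeneous_formOf c) hξ)
      filter_upwards [h1, h2] with z hz1 hz2 hz
      exact isNodeVec_of_det_borderedHessian_ne_zero (isHomogeneous_formOf z.1) hz hz1 hz2
    · push Not at hs
      obtain ⟨i, hi⟩ := hs
      have := (continuous_eval_formOf (m := m) (pderiv i).toLinearMap).continuousAt.eventually_ne
        (x := (c, x)) hi
      filter_upwards [this] with z hz hz'
      exact absurd (hz' i) hz
  -- Every point of the plane has a representative on the unit sphere, which is compact.
  have := (isCompact_sphere (0 : Fin 3 → ℂ) 1).eventually_forall_of_forall_eventually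
    (P := fun c' x => (∀ i, eval x (pderiv i (formOf m c')) = 0) → IsNodeVec (formOf m c') x) hloc
  filter_upwards [this] with c' hc' x hx hs
  have hn : (‖x‖ : ℂ) ≠ 0 := by simpa using hx
  have h1 := hc' ((‖x‖ : ℂ)⁻¹ • x) (by
    rw [mem_sphere_zero_iff_norm, norm_smul]
    simp [hx]) fun i => by
      rw [eval_smul_point (isHomogeneous_formOf c').pderiv, hs i, mul_zero]
  have h2 := h1.smul (isHomogeneous_formOf c') hn
  rwa [smul_inv_smul₀ hn] at h2

/-! ### Irreducibility of small deformations -/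

/-- A homogeneous product is the product of the leading forms of its factors. -/
theorem isHomogeneous_mul_eq_mul_homogeneousComponent {σ : Type*} {A B : MvPolynomial σ ℂ}
    (h : (A * B).IsHomogeneous (A.totalDegree + B.totalDegree)) :
    A * B = homogeneousComponent A.totalDegree A * homogeneousComponent B.totalDegree B := by
  classical
  ext d
  by_cases hd : d.degree = A.totalDegree + B.totalDegree
  · rw [coeff_mul, coeff_mul]
    refine Finset.sum_congr rfl fun e he => ?_
    have hsum : e.1.degree + e.2.degree = A.totalDegree + B.totalDegree := by
      rw [← hd, ← Finset.HasAntidiagonal.mem_antidiagonal.1 he, map_add]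
    rw [coeff_homogeneousComponent, coeff_homogeneousComponent]
    by_cases h1 : e.1.degree = A.totalDegree
    · rw [if_pos h1, if_pos (by omega)]
    · rw [if_neg h1, zero_mul]
      rcases Nat.lt_or_gt_of_ne h1 with h2 | h2
      · rw [coeff_eq_zero_of_totalDegree_lt (f := B) (d := e.2), mul_zero]
        rw [← Finsupp.degree_apply]; omega
      · rw [coeff_eq_zero_of_totalDegree_lt (f := A) (d := e.1), zero_mul]
        rw [← Finsupp.degree_apply]; omega
  · rw [h.coeff_eq_zero hd, ((homogeneousComponent_isHomogeneous _ A).mul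
      (homogeneousComponent_isHomogeneous _ B)).coeff_eq_zero hd]

theorem isUnit_of_totalDegree_eq_zero {σ : Type*} {A : MvPolynomial σ ℂ} (hA : A ≠ 0)
    (h : A.totalDegree = 0) : IsUnit A := by
  rw [totalDegree_eq_zero_iff_eq_C] at h
  rw [h] at hA ⊢
  exact (IsUnit.mk0 _ fun h0 => hA (by rw [h0, C_0])).map C

/-- A form is irreducible if it is not a product of two forms of smaller degree. -/
theorem irreducible_of_forall_isHomogeneous {σ : Type*} {F : MvPolynomial σ ℂ} {m : ℕ}
    (hm : m ≠ 0) (hF : F.IsHomogeneous m) (hF0 : F ≠ 0)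
    (h : ∀ a b : ℕ, a ≠ 0 → b ≠ 0 → a + b = m → ∀ A B : MvPolynomial σ ℂ,
      A.IsHomogeneous a → B.IsHomogeneous b → F ≠ A * B) : Irreducible F where
  not_isUnit hu := hm (by
    rw [← hF.totalDegree hF0]
    exact (isUnit_iff_totalDegree_of_isReduced.1 hu).2)
  isUnit_or_isUnit A B hAB := by
    subst hAB
    have hA := left_ne_zero_of_mul hF0
    have hB := right_ne_zero_of_mul hF0
    have hdeg : A.totalDegree + B.totalDegree = m := by
      rw [← totalDegree_mul_of_isDomain hA hB, hF.totalDegree hF0]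
    by_contra! hc
    refine h _ _ (fun h0 => hc.1 (isUnit_of_totalDegree_eq_zero hA h0))
      (fun h0 => hc.2 (isUnit_of_totalDegree_eq_zero hB h0)) hdeg _ _
      (homogeneousComponent_isHomogeneous _ A) (homogeneousComponent_isHomogeneous _ B)
      (isHomogeneous_mul_eq_mul_homogeneousComponent (hdeg ▸ hF))

/-- The Hessian of a product `A B` at a common zero is `∇A ∇Bᵀ + ∇B ∇Aᵀ`; so a common zero that is
a node of the product is a transversal intersection point. -/
theorem IsNodeVec.surjective_gradCLM_prod {A B : MvPolynomial (Fin 3) ℂ} {p : Fin 3 → ℂ}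
    (hA : eval p A = 0) (hB : eval p B = 0) (hn : IsNodeVec (A * B) p) :
    Function.Surjective ((gradCLM A p).prod (gradCLM B p)) := by
  have hker : ∀ y, (gradCLM A p).prod (gradCLM B p) y = 0 → ∃ μ : ℂ, y = μ • p := fun y hy => by
    have h1 : ∑ j, eval p (pderiv j A) * y j = 0 := by
      rw [← gradCLM_apply]; exact congrArg Prod.fst hy
    have h2 : ∑ j, eval p (pderiv j B) * y j = 0 := by
      rw [← gradCLM_apply]; exact congrArg Prod.snd hy
    refine hn.ker_hessian y fun i => ?_
    calc _ = eval p (pderiv i A) * ∑ j, eval p (pderiv j B) * y j +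
          eval p (pderiv i B) * ∑ j, eval p (pderiv j A) * y j := by
          rw [Finset.mul_sum, Finset.mul_sum, ← Finset.sum_add_distrib]
          refine Finset.sum_congr rfl fun j _ => ?_
          simp only [Derivation.leibniz, map_add, smul_eq_mul, map_mul, hA, hB]
          ring
      _ = 0 := by rw [h1, h2, mul_zero, mul_zero, add_zero]
  set g := ((gradCLM A p).prod (gradCLM B p) : (Fin 3 → ℂ) →ₗ[ℂ] ℂ × ℂ) with hg
  have hle : LinearMap.ker g ≤ Submodule.span ℂ {p} := fun y hy => by
    obtain ⟨μ, rfl⟩ := hker y hy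
    exact Submodule.smul_mem _ _ (Submodule.mem_span_singleton_self p)
  have h1 := (Submodule.finrank_mono hle).trans (finrank_span_singleton hn.ne_zero).le
  have h2 := LinearMap.finrank_range_add_finrank_ker g
  rw [Module.finrank_fin_fun] at h2
  have h3 : Module.finrank ℂ (ℂ × ℂ) = 2 := by simp
  refine LinearMap.range_eq_top.1 (Submodule.eq_top_of_finrank_eq (S := LinearMap.range g)
    (le_antisymm (Submodule.finrank_le _) ?_))
  omega

/-- A zero at which the partial differential is surjective persists under variation of the
parameter. -/
theorem eventually_exists_zero_of_surjective {E F G : Type*} [NormedAddCommGroup E]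
    [NormedSpace ℂ E] [CompleteSpace E] [NormedAddCommGroup F] [NormedSpace ℂ F] [CompleteSpace F]
    [NormedAddCommGroup G] [NormedSpace ℂ G] [CompleteSpace G] {f : E × F → G}
    {f' : E × F →L[ℂ] G} {a : E} {p : F} (hf : HasStrictFDerivAt f f' (a, p)) (h0 : f (a, p) = 0)
    (hsurj : Function.Surjective fun y => f' (0, y)) {U : Set F} (hU : U ∈ 𝓝 p) :
    ∀ᶠ z in 𝓝 a, ∃ x ∈ U, f (z, x) = 0 := by
  have hfst : HasStrictFDerivAt (Prod.fst : E × F → E) (.fst ℂ E F) (a, p) :=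
    hasStrictFDerivAt_fst
  have hmap := (hfst.prodMk hf).map_nhds_eq_of_surj (LinearMap.range_eq_top.2 (by
    rintro ⟨v, r⟩
    obtain ⟨y, hy⟩ := hsurj (r - f' (v, 0))
    refine ⟨(v, y), Prod.ext rfl ?_⟩
    change f' (v, y) = r
    have : ((v, y) : E × F) = (v, 0) + (0, y) := by simp
    rw [this, map_add]
    exact add_eq_of_eq_sub' hy))
  have himg := image_mem_map (m := fun z : E × F => (z.1, f z))
    (prod_mem_nhds (univ_mem : Set.univ ∈ 𝓝 a) hU)
  rw [hmap, h0] at himg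
  have hT : Tendsto (fun z : E => (z, (0 : G))) (𝓝 a) (𝓝 (a, 0)) :=
    (Continuous.prodMk_left _).tendsto _
  filter_upwards [hT himg] with z hz
  obtain ⟨⟨w, x⟩, hw, hwz⟩ := hz
  obtain ⟨rfl, h1⟩ := Prod.mk.inj hwz
  exact ⟨x, hw.2, h1⟩

/-- A transversal intersection point of two curves persists under deformation of the curves. -/
theorem eventually_exists_common_zero {a b : ℕ} {A : CoeffVec a} {B : CoeffVec b} {p : Fin 3 → ℂ}
    (hA : eval p (formOf a A) = 0) (hB : eval p (formOf b B) = 0)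
    (hn : IsNodeVec (formOf a A * formOf b B) p) {U : Set (Fin 3 → ℂ)} (hU : U ∈ 𝓝 p) :
    ∀ᶠ z in 𝓝 (A, B), ∃ x ∈ U, eval x (formOf a z.1) = 0 ∧ eval x (formOf b z.2) = 0 := by
  have hfA := HasStrictFDerivAt.comp ((A, B), p)
      (g := fun z : CoeffVec a × (Fin 3 → ℂ) => eval z.2 (formOf a z.1))
      (hasStrictFDerivAt_eval_formOf LinearMap.id (A, p))
      (((ContinuousLinearMap.fst ℂ (CoeffVec a) (CoeffVec b)).comp
        (.fst ℂ _ (Fin 3 → ℂ))).prod (.snd ℂ _ (Fin 3 → ℂ))).hasStrictFDerivAt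
  have hfB := HasStrictFDerivAt.comp ((A, B), p)
      (g := fun z : CoeffVec b × (Fin 3 → ℂ) => eval z.2 (formOf b z.1))
      (hasStrictFDerivAt_eval_formOf LinearMap.id (B, p))
      (((ContinuousLinearMap.snd ℂ (CoeffVec a) (CoeffVec b)).comp
        (.fst ℂ _ (Fin 3 → ℂ))).prod (.snd ℂ _ (Fin 3 → ℂ))).hasStrictFDerivAt
  have h := eventually_exists_zero_of_surjective (hfA.prodMk hfB) (Prod.ext hA hB)
    (fun r => by
      obtain ⟨y, hy⟩ := hn.surjective_gradCLM_prod hA hB r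
      refine ⟨y, ?_⟩
      rw [← hy]
      refine Prod.ext ?_ ?_ <;> simp) hU
  filter_upwards [h] with z hz
  obtain ⟨x, hx, hzx⟩ := hz
  exact ⟨x, hx, congrArg Prod.fst hzx, congrArg Prod.snd hzx⟩

theorem tendsto_eval_formOf {m : ℕ} {α : Type*} {l : Filter α} {A : α → CoeffVec m}
    {A₀ : CoeffVec m} (hA : Tendsto A l (𝓝 A₀)) (x : Fin 3 → ℂ) :
    Tendsto (fun t => eval x (formOf m (A t))) l (𝓝 (eval x (formOf m A₀))) := by
  have h := ((evalCLM (m := m) LinearMap.id x).continuous.tendsto A₀).comp hA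
  simpa [Function.comp_def] using h

/-- The curves that split into curves of degrees `a` and `b` form a closed set, and the factors can
be chosen convergent along an ultrafilter: after normalization they vary in a compact set. -/
theorem exists_tendsto_factors {m a b : ℕ} {α : Type*} {l : Ultrafilter α} {γ : α → CoeffVec m}
    {c : CoeffVec m} (hγ : Tendsto γ l (𝓝 c)) (hc : c ≠ 0)
    (h : ∀ᶠ t in l, ∃ (A : CoeffVec a) (B : CoeffVec b),
      formOf m (γ t) = formOf a A * formOf b B) :
    ∃ (A : α → CoeffVec a) (B : α → CoeffVec b) (A₀ : CoeffVec a) (B₀ : CoeffVec b),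
      Tendsto A l (𝓝 A₀) ∧ Tendsto B l (𝓝 B₀) ∧
      (∀ᶠ t in l, formOf m (γ t) = formOf a (A t) * formOf b (B t)) ∧
      formOf m c = formOf a A₀ * formOf b B₀ := by
  have hnorm : ∀ t, ∃ x : CoeffVec a × CoeffVec b × ℂ,
      ((∃ (A : CoeffVec a) (B : CoeffVec b), formOf m (γ t) = formOf a A * formOf b B) ∧
        γ t ≠ 0) → ‖x.1‖ = 1 ∧ ‖x.2.1‖ = 1 ∧
        formOf m (γ t) = x.2.2 • (formOf a x.1 * formOf b x.2.1) := fun t => by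
    by_cases ht : (∃ (A : CoeffVec a) (B : CoeffVec b), formOf m (γ t) = formOf a A * formOf b B) ∧
        γ t ≠ 0
    · obtain ⟨⟨A, B, hAB⟩, h0⟩ := ht
      have hA : A ≠ 0 := by rintro rfl; simp [formOf_eq_zero_iff, h0] at hAB
      have hB : B ≠ 0 := by rintro rfl; simp [formOf_eq_zero_iff, h0] at hAB
      have hA' : (‖A‖ : ℂ) ≠ 0 := by simpa using hA
      have hB' : (‖B‖ : ℂ) ≠ 0 := by simpa using hB
      refine ⟨((‖A‖ : ℂ)⁻¹ • A, (‖B‖ : ℂ)⁻¹ • B, (‖A‖ : ℂ) * ‖B‖), fun _ =>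
        ⟨by simp [norm_smul, hA], by simp [norm_smul, hB], ?_⟩⟩
      rw [hAB, map_smul, map_smul, smul_mul_smul_comm, smul_smul,
        show (‖A‖ : ℂ) * ‖B‖ * ((‖A‖ : ℂ)⁻¹ * (‖B‖ : ℂ)⁻¹) = 1 by field_simp, one_smul]
    · exact ⟨0, fun h => absurd h ht⟩
  choose x hx using hnorm
  have hgood : ∀ᶠ t in l, ‖(x t).1‖ = 1 ∧ ‖(x t).2.1‖ = 1 ∧
      formOf m (γ t) = (x t).2.2 • (formOf a (x t).1 * formOf b (x t).2.1) := by
    filter_upwards [h, hγ.eventually_ne hc] with t h1 h2 using hx t ⟨h1, h2⟩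
  obtain ⟨A₀, hA₀, hA⟩ := (isCompact_sphere (0 : CoeffVec a) 1).ultrafilter_le_nhds
    (l.map fun t => (x t).1) (by
      rw [Ultrafilter.coe_map, le_principal_iff, mem_map]
      filter_upwards [hgood] with t ht
      simpa using ht.1)
  obtain ⟨B₀, hB₀, hB⟩ := (isCompact_sphere (0 : CoeffVec b) 1).ultrafilter_le_nhds
    (l.map fun t => (x t).2.1) (by
      rw [Ultrafilter.coe_map, le_principal_iff, mem_map]
      filter_upwards [hgood] with t ht
      simpa using ht.2.1)
  replace hA : Tendsto (fun t => (x t).1) l (𝓝 A₀) := hA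
  replace hB : Tendsto (fun t => (x t).2.1) l (𝓝 B₀) := hB
  have hA0 : formOf a A₀ ≠ 0 := by
    rw [Ne, formOf_eq_zero_iff]; rintro rfl; simp at hA₀
  have hB0 : formOf b B₀ ≠ 0 := by
    rw [Ne, formOf_eq_zero_iff]; rintro rfl; simp at hB₀
  -- The scalar factor converges, as can be seen at a point where the limit forms do not vanish.
  obtain ⟨y, hy⟩ : ∃ y, eval y (formOf a A₀ * formOf b B₀) ≠ 0 := by
    by_contra! hy
    exact mul_ne_zero hA0 hB0 (MvPolynomial.funext fun y => by rw [hy y, map_zero])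
  have hprod : ∀ z, Tendsto (fun t => eval z (formOf a (x t).1 * formOf b (x t).2.1)) l
      (𝓝 (eval z (formOf a A₀ * formOf b B₀))) := fun z => by
    simp only [map_mul]
    exact (tendsto_eval_formOf hA z).mul (tendsto_eval_formOf hB z)
  set s₀ := eval y (formOf m c) / eval y (formOf a A₀ * formOf b B₀) with hs₀
  have hs : Tendsto (fun t => (x t).2.2) l (𝓝 s₀) := by
    refine ((tendsto_eval_formOf hγ y).div (hprod y) hy).congr' ?_
    filter_upwards [hgood, (hprod y).eventually_ne hy] with t ht hne
    rw [Pi.div_apply, ht.2.2, smul_eval, mul_div_cancel_right₀ _ hne]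
  refine ⟨fun t => (x t).1, fun t => (x t).2.2 • (x t).2.1, A₀, s₀ • B₀, hA, hs.smul hB, ?_, ?_⟩
  · filter_upwards [hgood] with t ht
    rw [ht.2.2, map_smul, mul_smul_comm]
  · refine MvPolynomial.funext fun z => tendsto_nhds_unique (tendsto_eval_formOf hγ z) ?_
    rw [map_smul, mul_smul_comm, smul_eval]
    refine (hs.mul (hprod z)).congr' ?_
    filter_upwards [hgood] with t ht
    rw [ht.2.2, smul_eval]

/-- Small deformations of a curve are irreducible if, for every splitting of the curve, some node in
which the two parts meet is smoothed: if the deformed curves split, then the two parts would still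
meet near that node. -/
theorem eventually_irreducible {m : ℕ} (hm : m ≠ 0) {α : Type*} {l : Filter α}
    {γ : α → CoeffVec m} {c : CoeffVec m} (hγ : Tendsto γ l (𝓝 c)) (hc : c ≠ 0)
    (h : ∀ a b : ℕ, a ≠ 0 → b ≠ 0 → a + b = m → ∀ A B : MvPolynomial (Fin 3) ℂ,
      A.IsHomogeneous a → B.IsHomogeneous b → formOf m c = A * B →
      ∃ p, eval p A = 0 ∧ eval p B = 0 ∧ IsNodeVec (formOf m c) p ∧
        ∀ᶠ z in l ×ˢ 𝓝 p, ¬ ∀ i, eval z.2 (pderiv i (formOf m (γ z.1))) = 0) :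
    ∀ᶠ t in l, Irreducible (formOf m (γ t)) := by
  have key : ∀ a b : ℕ, a ≠ 0 → b ≠ 0 → a + b = m → ∀ᶠ t in l,
      ¬ ∃ (A : CoeffVec a) (B : CoeffVec b), formOf m (γ t) = formOf a A * formOf b B := by
    intro a b ha hb hab
    by_contra hcon
    rw [not_eventually] at hcon
    simp only [not_not] at hcon
    obtain ⟨u, hul, hu⟩ : ∃ u : Ultrafilter α, (u : Filter α) ≤ l ∧ ∀ᶠ t in u,
        ∃ (A : CoeffVec a) (B : CoeffVec b), formOf m (γ t) = formOf a A * formOf b B := by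
      have : (l ⊓ 𝓟 {t | ∃ (A : CoeffVec a) (B : CoeffVec b),
        formOf m (γ t) = formOf a A * formOf b B}).NeBot := frequently_mem_iff_neBot.1 hcon
      exact ⟨Ultrafilter.of _, (Ultrafilter.of_le _).trans inf_le_left,
        le_principal_iff.1 ((Ultrafilter.of_le _).trans inf_le_right)⟩
    obtain ⟨A, B, A₀, B₀, hA, hB, hfac, hfac₀⟩ := exists_tendsto_factors (hγ.mono_left hul) hc hu
    obtain ⟨p, hpA, hpB, hn, hsm⟩ := h a b ha hb hab _ _ (isHomogeneous_formOf A₀)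
      (isHomogeneous_formOf B₀) hfac₀
    obtain ⟨P, hP, Q, hQ, hPQ⟩ := eventually_prod_iff.1 hsm
    have h1 := (hA.prodMk_nhds hB).eventually
      (eventually_exists_common_zero hpA hpB (hfac₀ ▸ hn) hQ)
    obtain ⟨t, ⟨x, hxQ, hx1, hx2⟩, ht, hPt⟩ := (h1.and (hfac.and (hul hP))).exists
    refine hPQ hPt hxQ fun i => ?_
    simp [ht, Derivation.leibniz, hx1, hx2]
  have hall : ∀ᶠ t in l, ∀ ab ∈ Finset.HasAntidiagonal.antidiagonal m, ab.1 ≠ 0 → ab.2 ≠ 0 →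
      ¬ ∃ (A : CoeffVec ab.1) (B : CoeffVec ab.2),
        formOf m (γ t) = formOf ab.1 A * formOf ab.2 B := by
    rw [eventually_all_finset]
    intro ab hab
    by_cases h1 : ab.1 ≠ 0
    · by_cases h2 : ab.2 ≠ 0
      · filter_upwards [key ab.1 ab.2 h1 h2 (Finset.HasAntidiagonal.mem_antidiagonal.1 hab)]
          with t ht _ _ using ht
      · exact Eventually.of_forall fun t _ h => absurd h h2
    · exact Eventually.of_forall fun t h => absurd h h1
  filter_upwards [hall, hγ.eventually_ne hc] with t ht h0
  refine irreducible_of_forall_isHomogeneous hm (isHomogeneous_formOf _)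
    (formOf_eq_zero_iff.not.2 h0) fun a b ha hb hab A B hA hB hAB => ?_
  refine ht (a, b) (Finset.HasAntidiagonal.mem_antidiagonal.2 hab) ha hb
    ⟨coeffVec a A, coeffVec b B, ?_⟩
  rw [formOf_coeffVec hA, formOf_coeffVec hB, hAB]

/-! ### Arrangements of lines in general position -/

/-- The linear form with coefficient vector `a`. -/
noncomputable def linForm (a : Fin 3 → ℂ) : MvPolynomial (Fin 3) ℂ := ∑ i, C (a i) * X i

@[simp] theorem eval_linForm (a x : Fin 3 → ℂ) : eval x (linForm a) = a ⬝ᵥ x := by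
  simp [linForm, dotProduct]

@[simp] theorem pderiv_linForm (a : Fin 3 → ℂ) (i : Fin 3) : pderiv i (linForm a) = C (a i) := by
  simp [linForm, pderiv_X, Pi.single_apply]

theorem isHomogeneous_linForm (a : Fin 3 → ℂ) : (linForm a).IsHomogeneous 1 :=
  IsHomogeneous.sum _ _ _ fun _ _ => isHomogeneous_C_mul_X _ _

theorem linForm_ne_zero {a : Fin 3 → ℂ} (ha : a ≠ 0) : linForm a ≠ 0 := fun h => by
  refine ha (funext fun i => ?_)
  have := congrArg (pderiv i) h
  rw [pderiv_linForm, map_zero, C_eq_zero] at this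
  exact this

theorem irreducible_linForm {a : Fin 3 → ℂ} (ha : a ≠ 0) : Irreducible (linForm a) :=
  irreducible_of_forall_isHomogeneous one_ne_zero (isHomogeneous_linForm a) (linForm_ne_zero ha)
    fun p q hp hq h => by omega

/-- Two distinct lines meet in the single point given by the cross product. -/
theorem exists_eq_smul_cross {a b x : Fin 3 → ℂ} (hab : a ⨯₃ b ≠ 0) (ha : a ⬝ᵥ x = 0)
    (hb : b ⬝ᵥ x = 0) : ∃ μ : ℂ, x = μ • (a ⨯₃ b) := by
  have h : (a ⨯₃ b) ⨯₃ x = 0 := by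
    rw [cross_cross_eq_smul_sub_smul, ha, hb, zero_smul, zero_smul, sub_zero]
  by_contra! hne
  have hli := (LinearIndependent.pair_iff' hab).2 fun r hr => hne r hr.symm
  exact (crossProduct_ne_zero_iff_linearIndependent.2 hli) h

/-- The intersection point of two lines is a node of any curve that consists of these lines and a
curve not passing through the point. -/
theorem isNodeVec_mul_mul {a b : Fin 3 → ℂ} (hab : a ⨯₃ b ≠ 0) {Q : MvPolynomial (Fin 3) ℂ}
    (hQ : eval (a ⨯₃ b) Q ≠ 0) : IsNodeVec (linForm a * linForm b * Q) (a ⨯₃ b) where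
  ne_zero := hab
  pderiv_eq_zero i := by simp [Derivation.leibniz]
  ker_hessian y hy := by
    have hess : ∀ i j, eval (a ⨯₃ b) (pderiv j (pderiv i (linForm a * linForm b * Q))) =
        eval (a ⨯₃ b) Q * (a i * b j + b i * a j) := fun i j => by
      simp only [Derivation.leibniz, pderiv_linForm, map_add, smul_eq_mul, map_mul, eval_linForm,
        pderiv_C, dot_self_cross, dot_cross_self, eval_C, mul_zero, zero_mul, add_zero,
        zero_add]
      ring
    have h1 : ∀ i, a i * (b ⬝ᵥ y) + b i * (a ⬝ᵥ y) = 0 := fun i => by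
      refine (mul_eq_zero.1 ?_).resolve_left hQ
      rw [← hy i, dotProduct, dotProduct, Finset.mul_sum, Finset.mul_sum, ← Finset.sum_add_distrib,
        Finset.mul_sum]
      refine Finset.sum_congr rfl fun j _ => ?_
      rw [hess]
      ring
    have h2 : (b ⬝ᵥ y) • a + (a ⬝ᵥ y) • b = 0 := funext fun i => by
      rw [Pi.add_apply, Pi.smul_apply, Pi.smul_apply, smul_eq_mul, smul_eq_mul, Pi.zero_apply,
        ← h1 i]
      ring
    have hli : LinearIndependent ℂ ![a, b] := crossProduct_ne_zero_iff_linearIndependent.1 hab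
    obtain ⟨h3, h4⟩ := LinearIndependent.pair_iff.1 hli _ _ h2
    exact exists_eq_smul_cross hab h4 h3

/-- The lines with equations `a i` are pairwise distinct and no three of them are concurrent. -/
structure IsGeneral {n : ℕ} (a : Fin n → Fin 3 → ℂ) : Prop where
  cross_ne_zero : ∀ i j, i ≠ j → a i ⨯₃ a j ≠ 0
  not_concurrent : ∀ i j k, i ≠ j → i ≠ k → j ≠ k → ∀ x ≠ 0,
    ¬ (a i ⬝ᵥ x = 0 ∧ a j ⬝ᵥ x = 0 ∧ a k ⬝ᵥ x = 0)

/-- The pairs of lines of an arrangement of `n` lines, which index its nodes. -/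
abbrev LinePair (n : ℕ) : Type := {e : Fin n × Fin n // e.1 < e.2}

/-- The line `i` is a member of the pair `e`. -/
def LinePair.Mem {n : ℕ} (i : Fin n) (e : LinePair n) : Prop := e.1.1 = i ∨ e.1.2 = i

instance {n : ℕ} (i : Fin n) : DecidablePred (LinePair.Mem i) := fun e =>
  inferInstanceAs (Decidable (e.1.1 = i ∨ e.1.2 = i))

theorem LinePair.exists_mem {n : ℕ} {i j : Fin n} (hij : i ≠ j) :
    ∃ e : LinePair n, e.Mem i ∧ e.Mem j := by
  rcases lt_or_gt_of_ne hij with h | h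
  · exact ⟨⟨(i, j), h⟩, Or.inl rfl, Or.inr rfl⟩
  · exact ⟨⟨(j, i), h⟩, Or.inr rfl, Or.inl rfl⟩

theorem LinePair.exists_mem_not_mem {n : ℕ} {e f : LinePair n} (h : e ≠ f) :
    ∃ k, f.Mem k ∧ ¬ e.Mem k := by
  by_contra! hc
  have h1 := hc f.1.1 (Or.inl rfl)
  have h2 := hc f.1.2 (Or.inr rfl)
  have he := e.2
  have hf := f.2
  refine h (Subtype.ext (Prod.ext ?_ ?_)) <;> unfold LinePair.Mem at h1 h2 <;> omega

/-- The common point of a pair of lines. -/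
def nodeOf {n : ℕ} (a : Fin n → Fin 3 → ℂ) (e : LinePair n) : Fin 3 → ℂ := a e.1.1 ⨯₃ a e.1.2

/-- The equation of the union of the lines of an arrangement. -/
noncomputable def arrangement {n : ℕ} (a : Fin n → Fin 3 → ℂ) : MvPolynomial (Fin 3) ℂ :=
  ∏ i, linForm (a i)

theorem isHomogeneous_arrangement {n : ℕ} (a : Fin n → Fin 3 → ℂ) :
    (arrangement a).IsHomogeneous n := by
  have := IsHomogeneous.prod Finset.univ (fun i => linForm (a i)) (fun _ => 1)
    fun i _ => isHomogeneous_linForm (a i)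
  simpa [arrangement] using this

/-- The union of the lines of an arrangement that are not in the pair `e`. -/
noncomputable def complementaryLines {n : ℕ} (a : Fin n → Fin 3 → ℂ) (e : LinePair n) :
    MvPolynomial (Fin 3) ℂ :=
  ∏ i ∈ (Finset.univ.erase e.1.1).erase e.1.2, linForm (a i)

theorem arrangement_eq_mul {n : ℕ} (a : Fin n → Fin 3 → ℂ) (e : LinePair n) :
    arrangement a = linForm (a e.1.1) * linForm (a e.1.2) * complementaryLines a e := by
  rw [arrangement, complementaryLines, mul_assoc, Finset.mul_prod_erase _ (fun i => linForm (a i))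
    (Finset.mem_erase.2 ⟨e.2.ne', Finset.mem_univ _⟩), Finset.mul_prod_erase _
    (fun i => linForm (a i)) (Finset.mem_univ _)]

theorem isHomogeneous_complementaryLines {n : ℕ} (a : Fin n → Fin 3 → ℂ) (e : LinePair n) :
    (complementaryLines a e).IsHomogeneous (n - 2) := by
  have := IsHomogeneous.prod ((Finset.univ.erase e.1.1).erase e.1.2) (fun i => linForm (a i))
    (fun _ => 1) fun i _ => isHomogeneous_linForm (a i)
  have hcard : ((Finset.univ.erase e.1.1).erase e.1.2).card = n - 2 := by
    rw [Finset.card_erase_of_mem (Finset.mem_erase.2 ⟨e.2.ne', Finset.mem_univ _⟩),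
      Finset.card_erase_of_mem (Finset.mem_univ _), Finset.card_univ, Fintype.card_fin]
    omega
  simpa [complementaryLines, hcard] using this

namespace IsGeneral

variable {n : ℕ} {a : Fin n → Fin 3 → ℂ}

theorem nodeOf_ne_zero (h : IsGeneral a) (e : LinePair n) : nodeOf a e ≠ 0 :=
  h.cross_ne_zero _ _ e.2.ne

theorem dotProduct_nodeOf_eq_zero_iff (h : IsGeneral a) (k : Fin n) (e : LinePair n) :
    a k ⬝ᵥ nodeOf a e = 0 ↔ e.Mem k := by
  constructor
  · intro hk
    by_contra hmem
    rw [LinePair.Mem, not_or] at hmem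
    exact h.not_concurrent _ _ _ e.2.ne hmem.1 hmem.2 _ (h.nodeOf_ne_zero e)
      ⟨dot_self_cross _ _, dot_cross_self _ _, hk⟩
  · rintro (rfl | rfl)
    exacts [dot_self_cross _ _, dot_cross_self _ _]

theorem eval_complementaryLines_eq_zero_iff (h : IsGeneral a) (e f : LinePair n) :
    eval (nodeOf a f) (complementaryLines a e) = 0 ↔ e ≠ f := by
  simp only [complementaryLines, map_prod, eval_linForm, Finset.prod_eq_zero_iff,
    h.dotProduct_nodeOf_eq_zero_iff]
  constructor
  · rintro ⟨k, hk, hf⟩ rfl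
    simp only [Finset.mem_erase, Finset.mem_univ, and_true] at hk
    rcases hf with hf | hf
    · exact hk.2 hf.symm
    · exact hk.1 hf.symm
  · intro hne
    obtain ⟨k, hkf, hke⟩ := LinePair.exists_mem_not_mem hne
    rw [LinePair.Mem, not_or] at hke
    exact ⟨k, by simp [Ne.symm hke.1, Ne.symm hke.2], hkf⟩

theorem isNodeVec_nodeOf (h : IsGeneral a) (e : LinePair n) :
    IsNodeVec (arrangement a) (nodeOf a e) := by
  rw [arrangement_eq_mul a e]
  exact isNodeVec_mul_mul (h.nodeOf_ne_zero e)
    fun h0 => (h.eval_complementaryLines_eq_zero_iff e e).1 h0 rfl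

theorem nodeOf_cross_ne_zero (h : IsGeneral a) {e f : LinePair n} (hef : e ≠ f) :
    nodeOf a e ⨯₃ nodeOf a f ≠ 0 := by
  rw [crossProduct_ne_zero_iff_linearIndependent,
    LinearIndependent.pair_iff' (h.nodeOf_ne_zero e)]
  intro r hr
  obtain ⟨k, hke, hkf⟩ := LinePair.exists_mem_not_mem hef.symm
  refine hkf ((h.dotProduct_nodeOf_eq_zero_iff k f).1 ?_)
  rw [← hr, dotProduct_smul, (h.dotProduct_nodeOf_eq_zero_iff k e).2 hke, smul_zero]

theorem ne_zero (h : IsGeneral a) (hn : 2 ≤ n) (i : Fin n) : a i ≠ 0 := by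
  have : Nontrivial (Fin n) := Fin.nontrivial_iff_two_le.2 hn
  obtain ⟨j, hj⟩ := exists_ne i
  intro h0
  exact h.cross_ne_zero i j hj.symm (by rw [h0]; simp)

theorem arrangement_ne_zero (h : IsGeneral a) (hn : 2 ≤ n) : arrangement a ≠ 0 :=
  Finset.prod_ne_zero_iff.2 fun i _ => linForm_ne_zero (h.ne_zero hn i)

/-- All the singular points of a general arrangement are nodes. -/
theorem isNodeVec (h : IsGeneral a) (hn : 2 ≤ n) {x : Fin 3 → ℂ} (hx : x ≠ 0)
    (hs : ∀ i, eval x (pderiv i (arrangement a)) = 0) : IsNodeVec (arrangement a) x := by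
  have h0 : eval x (arrangement a) = 0 := by
    have := euler_eval (isHomogeneous_arrangement a) x
    simp only [hs, mul_zero, Finset.sum_const_zero] at this
    exact (mul_eq_zero.1 this.symm).resolve_left (Nat.cast_ne_zero.2 (by omega))
  obtain ⟨i, -, hi⟩ : ∃ i ∈ Finset.univ, a i ⬝ᵥ x = 0 := by
    simpa [arrangement, map_prod, Finset.prod_eq_zero_iff] using h0
  obtain ⟨d, hd⟩ := Function.ne_iff.1 (h.ne_zero hn i)
  have h1 := hs d
  rw [arrangement, ← Finset.mul_prod_erase _ _ (Finset.mem_univ i)] at h1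
  simp only [Derivation.leibniz, pderiv_linForm, map_add, smul_eq_mul, map_mul, eval_linForm, hi,
    zero_mul, zero_add, eval_C, map_prod] at h1
  obtain ⟨j, hj, hjx⟩ := Finset.prod_eq_zero_iff.1 ((mul_eq_zero.1 h1).resolve_right hd)
  have hij : i ≠ j := (Finset.ne_of_mem_erase hj).symm
  obtain ⟨e, hei, hej⟩ := LinePair.exists_mem hij
  have hex : a e.1.1 ⬝ᵥ x = 0 ∧ a e.1.2 ⬝ᵥ x = 0 := by
    rcases hei with hei | hei <;> rcases hej with hej | hej
    · exact absurd (hei.symm.trans hej) hij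
    · rw [hei, hej]; exact ⟨hi, hjx⟩
    · rw [hei, hej]; exact ⟨hjx, hi⟩
    · exact absurd (hei.symm.trans hej) hij
  obtain ⟨μ, rfl⟩ := exists_eq_smul_cross (h.nodeOf_ne_zero e) hex.1 hex.2
  exact (h.isNodeVec_nodeOf e).smul (isHomogeneous_arrangement a)
    fun h0 => hx (by rw [h0, zero_smul])

/-- The nodes of a general arrangement of `n` lines impose independent conditions on forms of degree
`n`: the product of a quadric and of the lines that do not pass through a node can be nonzero
at this node, and vanishes at the other ones. -/
theorem exists_dual_forms (h : IsGeneral a) :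
    ∃ q : LinePair n → CoeffVec n, ∀ e f,
      eval (nodeOf a f) (formOf n (q e)) = if e = f then 1 else 0 := by
  have key : ∀ e : LinePair n, ∃ c : CoeffVec n, ∀ f,
      eval (nodeOf a f) (formOf n c) = if e = f then 1 else 0 := by
    intro e
    obtain ⟨k, hk⟩ := Function.ne_iff.1 (h.nodeOf_ne_zero e)
    have hhom : (complementaryLines a e * X k ^ 2).IsHomogeneous n := by
      have := (isHomogeneous_complementaryLines a e).mul (isHomogeneous_X_pow (R := ℂ) k 2)
      have h2 : n - 2 + 2 = n := by have := e.2; omega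
      rwa [h2] at this
    refine ⟨(eval (nodeOf a e) (complementaryLines a e * X k ^ 2))⁻¹ •
      coeffVec n (complementaryLines a e * X k ^ 2), fun f => ?_⟩
    rw [map_smul, formOf_coeffVec hhom, smul_eval]
    split_ifs with hef
    · subst hef
      refine inv_mul_cancel₀ ?_
      rw [map_mul, map_pow, eval_X]
      exact mul_ne_zero (fun h0 => (h.eval_complementaryLines_eq_zero_iff e e).1 h0 rfl)
        (pow_ne_zero _ hk)
    · rw [map_mul (eval (nodeOf a f)), (h.eval_complementaryLines_eq_zero_iff e f).2 hef, zero_mul,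
        mul_zero]
  choose q hq using key
  exact ⟨q, hq⟩

/-- If a general arrangement is split into two parts, then on each line there is a node in which the
two parts meet. -/
theorem exists_common_node (h : IsGeneral a) (hn : 2 ≤ n) (i : Fin n)
    {A B : MvPolynomial (Fin 3) ℂ} (hA : ¬ IsUnit A) (hB : ¬ IsUnit B)
    (hAB : arrangement a = A * B) :
    ∃ e : LinePair n, e.Mem i ∧ eval (nodeOf a e) A = 0 ∧ eval (nodeOf a e) B = 0 := by
  have hAB0 : A * B ≠ 0 := hAB ▸ h.arrangement_ne_zero hn
  have hdvd : ∀ F : MvPolynomial (Fin 3) ℂ, F ∣ arrangement a → F ≠ 0 → ¬ IsUnit F →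
      ∃ k, linForm (a k) ∣ F := fun F hF hF0 hFu => by
    obtain ⟨π, hπ, hπF⟩ := WfDvdMonoid.exists_irreducible_factor hFu hF0
    obtain ⟨k, -, hk⟩ := (hπ.prime.dvd_finsetProd_iff _).1 (hπF.trans hF)
    exact ⟨k, ((hπ.dvd_symm (irreducible_linForm (h.ne_zero hn k))) hk).trans hπF⟩
  have hzero : ∀ (F : MvPolynomial (Fin 3) ℂ) (k : Fin n) (e : LinePair n), linForm (a k) ∣ F →
      e.Mem k → eval (nodeOf a e) F = 0 := fun F k e ⟨G, hG⟩ he => by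
    rw [hG, map_mul, eval_linForm, (h.dotProduct_nodeOf_eq_zero_iff k e).2 he, zero_mul]
  have hsplit : ∀ F G : MvPolynomial (Fin 3) ℂ, linForm (a i) ∣ F → (∃ k, linForm (a k) ∣ G) →
      ∃ e : LinePair n, e.Mem i ∧ eval (nodeOf a e) F = 0 ∧ eval (nodeOf a e) G = 0 := by
    rintro F G hF ⟨k, hk⟩
    -- If the line `i` is a component of both parts, then any node on it will do.
    by_cases hik : i = k
    · subst hik
      have : Nontrivial (Fin n) := Fin.nontrivial_iff_two_le.2 hn
      obtain ⟨j, hj⟩ := exists_ne i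
      obtain ⟨e, he, -⟩ := LinePair.exists_mem hj.symm
      exact ⟨e, he, hzero F i e hF he, hzero G i e hk he⟩
    · obtain ⟨e, he, he'⟩ := LinePair.exists_mem hik
      exact ⟨e, he, hzero F i e hF he, hzero G k e hk he'⟩
  have hi : linForm (a i) ∣ A * B := hAB ▸ Finset.dvd_prod_of_mem _ (Finset.mem_univ i)
  rcases (irreducible_linForm (h.ne_zero hn i)).prime.dvd_or_dvd hi with hi | hi
  · exact hsplit A B hi (hdvd B (hAB ▸ dvd_mul_left B A) (right_ne_zero_of_mul hAB0) hB)
  · obtain ⟨e, he, h1, h2⟩ :=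
      hsplit B A hi (hdvd A (hAB ▸ dvd_mul_right A B) (left_ne_zero_of_mul hAB0) hA)
    exact ⟨e, he, h2, h1⟩

end IsGeneral

theorem eventually_cross_ne_zero {α : Type*} {l : Filter α} {φ ψ : α → Fin 3 → ℂ}
    {p q : Fin 3 → ℂ} (hφ : Tendsto φ l (𝓝 p)) (hψ : Tendsto ψ l (𝓝 q)) (h : p ⨯₃ q ≠ 0) :
    ∀ᶠ t in l, φ t ⨯₃ ψ t ≠ 0 := by
  have hc : Continuous fun z : (Fin 3 → ℂ) × (Fin 3 → ℂ) => z.1 ⨯₃ z.2 := by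
    refine continuous_pi fun i => ?_
    fin_cases i <;> simp [cross_apply] <;> fun_prop
  exact ((hc.tendsto (p, q)).comp (hφ.prodMk_nhds hψ)).eventually_ne h

/-- A form that vanishes exactly at the nodes off the line `i` is the velocity of an arc of
irreducible nodal curves, on which the nodes off the line `i` persist. Every
splitting of the arrangement separates the line `i` from another line, so it is destroyed by
smoothing the nodes on the line `i`. -/
theorem IsGeneral.exists_arc {n : ℕ} {a : Fin n → Fin 3 → ℂ} (h : IsGeneral a) (hn : 2 ≤ n)
    (i : Fin n) {v : CoeffVec n}
    (hv : ∀ e, eval (nodeOf a e) (formOf n v) = 0 ↔ ¬ LinePair.Mem i e) :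
    ∃ γ : ℂ → CoeffVec n, γ 0 = coeffVec n (arrangement a) ∧ HasDerivAt γ v 0 ∧
      ∀ᶠ t in 𝓝[≠] 0, Irreducible (formOf n (γ t)) ∧
        (∀ x ≠ 0, (∀ j, eval x (pderiv j (formOf n (γ t))) = 0) → IsNodeVec (formOf n (γ t)) x) ∧
        ∃ ψ : {e : LinePair n // ¬ e.Mem i} → Fin 3 → ℂ,
          (∀ e, ψ e ≠ 0 ∧ ∀ j, eval (ψ e) (pderiv j (formOf n (γ t))) = 0) ∧
          Pairwise fun e f => ψ e ⨯₃ ψ f ≠ 0 := by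
  have hn0 : n ≠ 0 := by omega
  have hform : formOf n (coeffVec n (arrangement a)) = arrangement a :=
    formOf_coeffVec (isHomogeneous_arrangement a)
  have hc : coeffVec n (arrangement a) ≠ 0 := fun h0 => h.arrangement_ne_zero hn (by
    rw [← hform, h0, map_zero])
  obtain ⟨q, hq⟩ := h.exists_dual_forms
  obtain ⟨γ, hγ0, hγ, hpers, hsm⟩ := PlaneCurve.exists_arc hn0
    (fun e => hform.symm ▸ h.isNodeVec_nodeOf e) hq v
  have hγt : Tendsto γ (𝓝[≠] 0) (𝓝 (coeffVec n (arrangement a))) := by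
    rw [← hγ0]
    exact hγ.continuousAt.tendsto.mono_left nhdsWithin_le_nhds
  have hirr : ∀ᶠ t in 𝓝[≠] 0, Irreducible (formOf n (γ t)) := by
    refine eventually_irreducible hn0 hγt hc fun α β hα hβ _ A B hA hB hAB => ?_
    rw [hform] at hAB ⊢
    have hunit : ∀ {F : MvPolynomial (Fin 3) ℂ} {d : ℕ}, d ≠ 0 → F.IsHomogeneous d → F ≠ 0 →
        ¬ IsUnit F := fun hd hF hF0 hu =>
      hd ((hF.totalDegree hF0).symm.trans (isUnit_iff_totalDegree_of_isReduced.1 hu).2)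
    have hAB0 : A * B ≠ 0 := hAB ▸ h.arrangement_ne_zero hn
    obtain ⟨e, hei, heA, heB⟩ := h.exists_common_node hn i
      (hunit hα hA (left_ne_zero_of_mul hAB0)) (hunit hβ hB (right_ne_zero_of_mul hAB0)) hAB
    exact ⟨nodeOf a e, heA, heB, h.isNodeVec_nodeOf e, hsm e fun h0 => (hv e).1 h0 hei⟩
  have hnodal := hγt.eventually (eventually_isNodeVec fun x hx hs => by
    rw [hform] at hs ⊢
    exact h.isNodeVec hn hx hs)
  choose φ hφ hφs using fun e : {e : LinePair n // ¬ e.Mem i} => hpers e.1 ((hv e.1).2 e.2)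
  have h1 : ∀ᶠ t in 𝓝 0, ∀ e, φ e t ≠ 0 := eventually_all.2 fun e =>
    (hφ e).eventually_ne (h.nodeOf_ne_zero e.1)
  have h2 : ∀ᶠ t in 𝓝 0, ∀ e, ∀ j, eval (φ e t) (pderiv j (formOf n (γ t))) = 0 :=
    eventually_all.2 hφs
  have h3 : ∀ᶠ t in 𝓝 0, ∀ e f, e ≠ f → φ e t ⨯₃ φ f t ≠ 0 := by
    refine eventually_all.2 fun e => eventually_all.2 fun f => ?_
    by_cases hef : e = f
    · exact Eventually.of_forall fun t hne => absurd hef hne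
    · filter_upwards [eventually_cross_ne_zero (hφ e) (hφ f)
        (h.nodeOf_cross_ne_zero fun h0 => hef (Subtype.ext h0))] with t ht _ using ht
  refine ⟨γ, hγ0, hγ, ?_⟩
  filter_upwards [hirr, hnodal, nhdsWithin_le_nhds h1, nhdsWithin_le_nhds h2,
    nhdsWithin_le_nhds h3] with t ht1 ht2 ht3 ht4 ht5
  exact ⟨ht1, ht2, fun e => φ e t, fun e => ⟨ht3 e, ht4 e⟩, fun e f hef => ht5 e f hef⟩

/-! ### Plane curves and their equations -/

theorem isHomogeneous_equation {m : ℕ} (Γ : PlaneCurve m) : Γ.equation.IsHomogeneous m :=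
  (Γ.rep : TernaryForm m).2

theorem exists_equation_mk {m : ℕ} (F : TernaryForm m) (hF : F ≠ 0) :
    ∃ s : ℂ, s ≠ 0 ∧ equation (Projectivization.mk ℂ F hF) = s • (F : MvPolynomial (Fin 3) ℂ) := by
  obtain ⟨s, hs⟩ := Projectivization.exists_smul_eq_mk_rep ℂ F hF
  exact ⟨s, s.ne_zero, by rw [equation, ← hs]; rfl⟩

theorem exists_equation_sum {a b : ℕ} (Γ : PlaneCurve a) (Δ : PlaneCurve b) :
    ∃ s : ℂ, s ≠ 0 ∧ (Γ.sum Δ).equation = s • (Γ.equation * Δ.equation) :=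
  exists_equation_mk _ _

theorem eq_of_equation_eq_smul {m : ℕ} {Γ Δ : PlaneCurve m} {r : ℂ}
    (h : r • Δ.equation = Γ.equation) : Γ = Δ := by
  rw [← Projectivization.mk_rep Γ, ← Projectivization.mk_rep Δ, Projectivization.mk_eq_mk_iff']
  exact ⟨r, Subtype.ext h⟩

theorem sum_left_cancel {a b : ℕ} {Γ : PlaneCurve a} {Δ Δ' : PlaneCurve b}
    (h : Γ.sum Δ = Γ.sum Δ') : Δ = Δ' := by
  obtain ⟨s, hs, h1⟩ := exists_equation_sum Γ Δ
  obtain ⟨s', -, h2⟩ := exists_equation_sum Γ Δ'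
  rw [h, h2, ← mul_smul_comm, ← mul_smul_comm] at h1
  have h3 := mul_left_cancel₀ Γ.equation_ne_zero h1
  refine eq_of_equation_eq_smul (r := s⁻¹ * s') ?_
  rw [mul_smul, h3, inv_smul_smul₀ hs]

theorem finrank_pencil {m : ℕ} {Γ Δ : PlaneCurve m} (h : Γ ≠ Δ) :
    Module.finrank ℂ (pencil Γ Δ) = 2 := by
  have hli : LinearIndependent ℂ ![Γ.rep, Δ.rep] := by
    rw [LinearIndependent.pair_iff' Γ.rep_nonzero]
    intro r hr
    exact h (eq_of_equation_eq_smul (r := r) (congrArg Subtype.val hr)).symm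
  have h1 := finrank_span_eq_card hli
  rwa [Matrix.range_cons, Matrix.range_cons, Matrix.range_empty, Set.union_empty,
    Submodule.span_union, ← Projectivization.submodule_eq, ← Projectivization.submodule_eq,
    Fintype.card_fin] at h1

theorem exists_rep_eq_smul (x : Fin 3 → ℂ) (hx : x ≠ 0) :
    ∃ r : ℂ, r ≠ 0 ∧ (Projectivization.mk ℂ x hx).rep = r • x := by
  obtain ⟨r, hr⟩ := Projectivization.exists_smul_eq_mk_rep ℂ x hx
  exact ⟨r, r.ne_zero, hr.symm⟩

theorem mem_singularPoints_iff {m : ℕ} (hm : m ≠ 0) {Γ : PlaneCurve m} {x : ProjPlane} :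
    x ∈ Γ.singularPoints ↔ ∀ i, eval x.rep (pderiv i Γ.equation) = 0 := by
  refine ⟨fun h => h.2, fun h => ⟨?_, h⟩⟩
  have h1 := euler_eval (isHomogeneous_equation Γ) x.rep
  simp only [h, mul_zero, Finset.sum_const_zero] at h1
  exact (mul_eq_zero.1 h1.symm).resolve_left (Nat.cast_ne_zero.2 hm)

theorem IsNodeVec.const_smul {F : MvPolynomial (Fin 3) ℂ} {p : Fin 3 → ℂ} (h : IsNodeVec F p)
    {s : ℂ} (hs : s ≠ 0) : IsNodeVec (s • F) p where
  ne_zero := h.ne_zero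
  pderiv_eq_zero i := by
    rw [Derivation.map_smul, smul_eval, h.pderiv_eq_zero, mul_zero]
  ker_hessian y hy := h.ker_hessian y fun i => by
    have h1 := hy i
    simp only [Derivation.map_smul, smul_eval, mul_assoc, ← Finset.mul_sum] at h1
    exact (mul_eq_zero.1 h1).resolve_left hs

theorem IsNodeVec.isNode {m : ℕ} (hm : m ≠ 0) {Γ : PlaneCurve m} {x : ProjPlane}
    (h : IsNodeVec Γ.equation x.rep) : Γ.IsNode x := by
  refine ⟨(mem_singularPoints_iff hm).2 h.pderiv_eq_zero, ?_⟩
  have hmul : ∀ y i, (Γ.hessian x *ᵥ y) i =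
      ∑ j, eval x.rep (pderiv j (pderiv i Γ.equation)) * y j := fun y i => by
    simp only [hessian, Matrix.mulVec, dotProduct, Matrix.of_apply]
    exact Finset.sum_congr rfl fun j _ => by rw [pderiv_pderiv_comm]
  have hker : LinearMap.ker (Γ.hessian x).mulVecLin = Submodule.span ℂ {x.rep} := by
    ext y
    rw [LinearMap.mem_ker, Matrix.mulVecLin_apply, Submodule.mem_span_singleton]
    constructor
    · intro hy
      obtain ⟨μ, hμ⟩ := h.ker_hessian y fun i => by rw [← hmul, hy]; rfl
      exact ⟨μ, hμ.symm⟩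
    · rintro ⟨μ, rfl⟩
      funext i
      have h1 := euler_eval ((isHomogeneous_equation Γ).pderiv (i := i)) x.rep
      rw [h.pderiv_eq_zero, mul_zero] at h1
      rw [hmul, Pi.zero_apply]
      simp only [Pi.smul_apply, smul_eq_mul]
      calc _ = μ * ∑ j, x.rep j * eval x.rep (pderiv j (pderiv i Γ.equation)) := by
            rw [Finset.mul_sum]; exact Finset.sum_congr rfl fun j _ => by ring
        _ = 0 := by rw [h1, mul_zero]
  have h1 := LinearMap.finrank_range_add_finrank_ker (Γ.hessian x).mulVecLin
  rw [hker, finrank_span_singleton h.ne_zero, Module.finrank_fin_fun] at h1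
  rw [Matrix.rank]
  omega

/-- The curve with a given nonzero coefficient vector. -/
noncomputable def ofCoeffVec {m : ℕ} (c : CoeffVec m) (hc : c ≠ 0) : PlaneCurve m :=
  Projectivization.mk ℂ (⟨formOf m c, isHomogeneous_formOf c⟩ : TernaryForm m)
    fun h => hc (formOf_eq_zero_iff.1 (congrArg Subtype.val h))

theorem exists_equation_ofCoeffVec {m : ℕ} (c : CoeffVec m) (hc : c ≠ 0) :
    ∃ s : ℂ, s ≠ 0 ∧ (ofCoeffVec c hc).equation = s • formOf m c :=
  exists_equation_mk _ _

theorem ofCoeffVec_mem {m : ℕ} (hm : m ≠ 0) {c : CoeffVec m} (hc : c ≠ 0)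
    (hirr : Irreducible (formOf m c))
    (hnodal : ∀ x ≠ 0, (∀ j, eval x (pderiv j (formOf m c)) = 0) → IsNodeVec (formOf m c) x)
    {ι : Type*} {ψ : ι → Fin 3 → ℂ}
    (hψ : ∀ e, ψ e ≠ 0 ∧ ∀ j, eval (ψ e) (pderiv j (formOf m c)) = 0)
    (hpair : Pairwise fun e f => ψ e ⨯₃ ψ f ≠ 0) :
    (ofCoeffVec c hc).IsIntegral ∧ (ofCoeffVec c hc).IsNodal ∧
      ENat.card ι ≤ (ofCoeffVec c hc).singularPoints.encard := by
  obtain ⟨s, hs, heq⟩ := exists_equation_ofCoeffVec c hc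
  have hsing : ∀ x : ProjPlane, x ∈ (ofCoeffVec c hc).singularPoints ↔
      ∀ i, eval x.rep (pderiv i (formOf m c)) = 0 := fun x => by
    rw [mem_singularPoints_iff hm, heq]
    simp [Derivation.map_smul, smul_eval, hs]
  refine ⟨?_, fun x hx => ?_, ?_⟩
  · rw [IsIntegral, heq]
    have hassoc : Associated (formOf m c) (s • formOf m c) := by
      refine ⟨((IsUnit.mk0 s hs).map C).unit, ?_⟩
      rw [IsUnit.unit_spec, mul_comm, C_mul']
    exact hassoc.irreducible hirr
  · refine IsNodeVec.isNode hm ?_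
    rw [heq]
    exact (hnodal _ x.rep_nonzero ((hsing x).1 hx)).const_smul hs
  · have hinj : Function.Injective fun e => Projectivization.mk ℂ (ψ e) (hψ e).1 := by
      intro e f hef
      by_contra hne
      obtain ⟨r, hr⟩ := (Projectivization.mk_eq_mk_iff' ℂ _ _ _ _).1 hef
      refine hpair hne ?_
      rw [← hr]
      simp
    refine hinj.encard_range.trans (Set.encard_le_encard ?_)
    rintro _ ⟨e, rfl⟩
    obtain ⟨r, -, hr⟩ := exists_rep_eq_smul (ψ e) (hψ e).1
    refine (hsing _).2 fun i => ?_
    rw [hr, eval_smul_point (isHomogeneous_formOf c).pderiv, (hψ e).2 i, mul_zero]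

/-! ### The tangent space of the Severi variety at a general arrangement -/

theorem homogeneousVanishing_zariskiClosure_subset {m : ℕ} (X : Set (PlaneCurve m)) :
    homogeneousVanishing (zariskiClosure X) ⊆ homogeneousVanishing X :=
  fun _ hP => ⟨hP.1, fun Γ hΓ => hP.2 Γ fun _ hQ => hQ.2 Γ hΓ⟩

theorem coords_eq_smul {m : ℕ} {Γ : PlaneCurve m} {c : CoeffVec m} {s : ℂ}
    (h : Γ.equation = s • formOf m c) : Γ.coords = s • c := by
  funext d
  rw [coords, h, coeff_smul, coeff_formOf]
  rfl

namespace IsGeneral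

variable {n δ : ℕ} {a : Fin n → Fin 3 → ℂ}

/-- The equations of the family of integral nodal curves with at least `δ` nodes vanish at a general
arrangement to second order in the direction of each form that vanishes exactly at the nodes off a
given line. -/
theorem eval_eq_zero_of_vanishing_off_line (h : IsGeneral a) (hn : 2 ≤ n) (i : Fin n)
    (hδ : δ ≤ Fintype.card {e : LinePair n // ¬ e.Mem i})
    {P : MvPolynomial (MonomialIndex n) ℂ}
    (hP : P ∈ homogeneousVanishing
      {Γ : PlaneCurve n | Γ.IsIntegral ∧ Γ.IsNodal ∧ (δ : ℕ∞) ≤ Γ.singularPoints.encard})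
    {v : CoeffVec n} (hv : ∀ e, eval (nodeOf a e) (formOf n v) = 0 ↔ ¬ LinePair.Mem i e) :
    eval (coeffVec n (arrangement a)) P = 0 ∧
      gradCLM P (coeffVec n (arrangement a)) v = 0 := by
  obtain ⟨γ, hγ0, hγ, hev⟩ := h.exists_arc hn i hv
  obtain ⟨⟨k, hk⟩, hvan⟩ := hP
  have hzero : ∀ᶠ t in 𝓝[≠] (0 : ℂ), eval (γ t) P = 0 := by
    filter_upwards [hev] with t ht
    obtain ⟨hirr, hnod, ψ, hψ, hpair⟩ := ht
    have hc : γ t ≠ 0 := fun h0 => hirr.ne_zero (by rw [h0, map_zero])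
    obtain ⟨h1, h2, h3⟩ := ofCoeffVec_mem (by omega) hc hirr hnod hψ hpair
    have h4 := hvan _ ⟨h1, h2, le_trans (by
      rw [ENat.card_eq_coe_fintype_card]; exact_mod_cast hδ) h3⟩
    obtain ⟨s, hs, heq⟩ := exists_equation_ofCoeffVec (γ t) hc
    rw [coords_eq_smul heq, eval_smul_point hk] at h4
    exact (mul_eq_zero.1 h4).resolve_left (pow_ne_zero _ hs)
  have hderiv : HasDerivAt (fun t => eval (γ t) P) (gradCLM P (γ 0) v) 0 :=
    (hasStrictFDerivAt_eval P (γ 0)).hasFDerivAt.comp_hasDerivAt (0 : ℂ) hγ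
  have h0 : eval (γ 0) P = 0 :=
    tendsto_nhds_unique (hderiv.continuousAt.tendsto.mono_left nhdsWithin_le_nhds)
      (tendsto_const_nhds.congr' (by filter_upwards [hzero] with t ht using ht.symm))
  have hall : ∀ᶠ t in 𝓝 (0 : ℂ), eval (γ t) P = 0 := by
    rw [eventually_nhdsWithin_iff] at hzero
    filter_upwards [hzero] with t ht
    by_cases ht0 : t = 0
    · rw [ht0, h0]
    · exact ht ht0
  rw [← hγ0]
  exact ⟨h0, hderiv.unique ((hasDerivAt_const (0 : ℂ) (0 : ℂ)).congr_of_eventuallyEq hall)⟩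

/-- The equations of the Severi variety vanish to second order at a general arrangement: the tangent
spaces of the branches obtained by smoothing the nodes on one line span the space of all forms. -/
theorem gradCLM_eq_zero (h : IsGeneral a) (hn : 2 ≤ n)
    (hδ : ∀ i, δ ≤ Fintype.card {e : LinePair n // ¬ e.Mem i})
    {P : MvPolynomial (MonomialIndex n) ℂ}
    (hP : P ∈ homogeneousVanishing
      {Γ : PlaneCurve n | Γ.IsIntegral ∧ Γ.IsNodal ∧ (δ : ℕ∞) ≤ Γ.singularPoints.encard}) :
    eval (coeffVec n (arrangement a)) P = 0 ∧ gradCLM P (coeffVec n (arrangement a)) = 0 := by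
  obtain ⟨q, hq⟩ := h.exists_dual_forms
  set D := gradCLM P (coeffVec n (arrangement a)) with hD
  -- `w i` takes the value `1` at the nodes on the line `i`, and `0` at the other ones.
  set w : Fin n → CoeffVec n := fun i => ∑ e, if LinePair.Mem i e then q e else 0 with hw
  have hwev : ∀ i f, eval (nodeOf a f) (formOf n (w i)) = if LinePair.Mem i f then 1 else 0 :=
    fun i f => by
      simp only [hw, map_sum, apply_ite (formOf n), map_zero, apply_ite (eval (nodeOf a f)), hq]
      rw [Finset.sum_eq_single f (fun e _ hef => by simp [hef]) (by simp)]
      simp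
  have key := fun i (v : CoeffVec n) hv =>
    h.eval_eq_zero_of_vanishing_off_line hn i (hδ i) hP (v := v) hv
  have hwi := fun i => key i (w i) fun e => by rw [hwev]; simp
  have hker : ∀ v : CoeffVec n, (∀ e, eval (nodeOf a e) (formOf n v) = 0) → D v = 0 :=
      fun v hv => by
    have h1 := (key ⟨0, by omega⟩ (w ⟨0, by omega⟩ + v) fun e => by
      rw [map_add, map_add, hv e, add_zero, hwev]; simp).2
    rw [map_add] at h1
    simpa [(hwi ⟨0, by omega⟩).2] using h1
  -- Both `w i` and `w i + q e` vanish exactly at the nodes off the line `i`, if `e` contains `i`.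
  have hqe : ∀ e, D (q e) = 0 := fun e => by
    have h1 := (key e.1.1 (w e.1.1 + q e) fun f => by
      rw [map_add, map_add, hwev, hq]
      by_cases hef : e = f
      · subst hef
        have : LinePair.Mem e.1.1 e := Or.inl rfl
        simp [this, one_add_one_eq_two]
      · simp [hef]).2
    rw [map_add] at h1
    simpa [(hwi e.1.1).2] using h1
  refine ⟨(hwi ⟨0, by omega⟩).1, ContinuousLinearMap.ext fun v => ?_⟩
  have h1 := hker (v - ∑ e, eval (nodeOf a e) (formOf n v) • q e) fun f => by
    simp [hq, smul_eval]
  simpa [hqe] using h1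

end IsGeneral

/-- A general arrangement of lines lies on the Severi variety, and the Zariski tangent space at this
point is the whole projective space of curves. -/
theorem IsGeneral.mem_severiIrr_and_tangentSpace {n δ : ℕ} {a : Fin n → Fin 3 → ℂ}
    (h : IsGeneral a) (hn : 2 ≤ n) (hδ : ∀ i, δ ≤ Fintype.card {e : LinePair n // ¬ e.Mem i})
    {S : PlaneCurve n} {s : ℂ} (hS : S.equation = s • arrangement a) :
    S ∈ severiIrr n δ ∧ ∀ Δ, Δ ∈ projectiveTangentSpace (severiIrr n δ) S := by
  have hcoords : S.coords = s • coeffVec n (arrangement a) :=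
    coords_eq_smul (by rw [hS, formOf_coeffVec (isHomogeneous_arrangement a)])
  -- The coordinates of `S` are only determined up to the scalar `s`; the equations are homogeneous.
  refine ⟨fun P hP => ?_, fun Δ P hP => ?_⟩
  · obtain ⟨k, hk⟩ := hP.1
    rw [hcoords, eval_smul_point hk, (h.gradCLM_eq_zero hn hδ hP).1, mul_zero]
  · obtain ⟨k, hk⟩ := hP.1
    have h1 := (h.gradCLM_eq_zero hn hδ (homogeneousVanishing_zariskiClosure_subset _ hP)).2
    have h2 : ∀ d, eval S.coords (pderiv d P) =
        s ^ (k - 1) * eval (coeffVec n (arrangement a)) (pderiv d P) := fun d => by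
      rw [hcoords, eval_smul_point hk.pderiv]
    simp only [h2, mul_assoc]
    rw [← Finset.mul_sum, ← gradCLM_apply, h1, _root_.zero_apply, mul_zero]

theorem exists_equation_eq_linForm (L : PlaneCurve 1) : ∃ b, L.equation = linForm b := by
  have h : L.equation ∈ homogeneousSubmodule (Fin 3) ℂ 1 := isHomogeneous_equation L
  rw [homogeneousSubmodule_one_eq_span_X, Submodule.mem_span_range_iff_exists_fun] at h
  obtain ⟨b, hb⟩ := h
  exact ⟨b, by rw [← hb, linForm]; simp [smul_eq_C_mul]⟩

theorem InGeneralPosition.isGeneral {n : ℕ} {ι : Type} {L : ι → PlaneCurve 1}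
    (h : InGeneralPosition L) (σ : Fin n ≃ ι) {b : ι → Fin 3 → ℂ}
    (hb : ∀ i, (L i).equation = linForm (b i)) : IsGeneral fun k => b (σ k) where
  cross_ne_zero i j hij := by
    have hbi : b (σ i) ≠ 0 := fun h0 => (L (σ i)).equation_ne_zero (by
      rw [hb, h0]; simp [linForm])
    rw [crossProduct_ne_zero_iff_linearIndependent, LinearIndependent.pair_iff' hbi]
    intro r hr
    refine hij (σ.injective (h.1 (eq_of_equation_eq_smul (r := r) ?_))).symm
    rw [hb, hb, ← hr]
    simp [linForm, Finset.smul_sum, smul_eq_C_mul, mul_assoc]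
  not_concurrent i j k hij hik hjk x hx hxx := by
    obtain ⟨r, -, hr⟩ := exists_rep_eq_smul x hx
    have hcont : ∀ l, b l ⬝ᵥ x = 0 → (L l).Contains (Projectivization.mk ℂ x hx) := fun l hl => by
      rw [Contains, hb, eval_linForm, hr, dotProduct_smul, hl, smul_zero]
    exact h.2 (σ i) (σ j) (σ k) (σ.injective.ne hij) (σ.injective.ne hik) (σ.injective.ne hjk) _
      ⟨hcont _ hxx.1, hcont _ hxx.2.1, hcont _ hxx.2.2⟩

theorem exists_equation_threeLines (L : Fin 3 → PlaneCurve 1) :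
    ∃ s : ℂ, (threeLines L).equation = s • ∏ i, (L i).equation := by
  obtain ⟨s, -, hs⟩ := exists_equation_sum ((L 0).sum (L 1)) (L 2)
  obtain ⟨r, -, hr⟩ := exists_equation_sum (L 0) (L 1)
  exact ⟨s * r, by rw [threeLines, hs, hr, Fin.prod_univ_three, smul_mul_assoc, smul_smul]⟩

end PlaneCurve

/-- The six lines are the sides `ℓ 0, ℓ 1, ℓ 2` of the triangle `T` and the sides `m 0, m 1, m 2` of
the triangle `T'`. General position of the six lines includes that both are triangles and that
they have no common sides or vertices. If `F = T'`, the pencil is the single point `S`; otherwise it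
is a line. -/
theorem mainTheorem6 (ℓ m : Fin 3 → PlaneCurve 1)
    (hgen : PlaneCurve.InGeneralPosition (Sum.elim ℓ m))
    (T T' : PlaneCurve 3) (hT : T = PlaneCurve.threeLines ℓ) (hT' : T' = PlaneCurve.threeLines m)
    (S : PlaneCurve 6) (hS : S = T.sum T') (F : PlaneCurve 3) :
    PlaneCurve.IsTangentAt (PlaneCurve.pencil S (T.sum F)) (PlaneCurve.severiIrr 6 10) S ∧
      (F ≠ T' → Module.finrank ℂ (PlaneCurve.pencil S (T.sum F)) = 2) := by
  choose b hb using fun i => PlaneCurve.exists_equation_eq_linForm (Sum.elim ℓ m i)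
  have hg := hgen.isGeneral finSumFinEquiv.symm hb
  obtain ⟨s, hs⟩ : ∃ s : ℂ,
      S.equation = s • PlaneCurve.arrangement fun k => b (finSumFinEquiv.symm k) := by
    obtain ⟨s₁, h1⟩ := PlaneCurve.exists_equation_threeLines ℓ
    obtain ⟨s₂, h2⟩ := PlaneCurve.exists_equation_threeLines m
    obtain ⟨s₃, -, h3⟩ := PlaneCurve.exists_equation_sum T T'
    refine ⟨s₃ * (s₁ * s₂), ?_⟩
    rw [hS, h3, hT, hT', h1, h2, smul_mul_smul_comm, smul_smul, PlaneCurve.arrangement,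
      Equiv.prod_comp finSumFinEquiv.symm fun i => PlaneCurve.linForm (b i)]
    simp [← hb, Fintype.prod_sum_type]
  obtain ⟨hmem, htan⟩ := hg.mem_severiIrr_and_tangentSpace (δ := 10) (by norm_num) (by decide) hs
  refine ⟨⟨hmem, le_sup_left, fun Δ _ => htan Δ⟩, fun hF =>
    PlaneCurve.finrank_pencil fun h => hF ?_⟩
  exact (PlaneCurve.sum_left_cancel (hS.symm.trans h)).symm
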